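/- Let $k$ be a field, $K/k$ a field extension, and $A$ a (finite-dimensional) central simple $K$-algebra. The essential dimension $\operatorname{ed}(A)$ is the minimal transcendence degree over $k$ of an intermediate field $k \subseteq K_0 \subseteq K$ such that $A \cong A_0 \otimes_{K_0} K$ for some central simple $K_0$-algebra $A_0$. Let $G$ be a finite group and $H \le G$ a subgroup with $\bigcap_{g\in G} H^g = \{1\}$, where $H^g := gHg^{-1}$. Suppose that $A$ is a $G/H$-crossed product, i.e., there is a finite Galois extension $E/K$ with $\operatorname{Gal}(E/K) \cong G$ such that the fixed field $L = E^H$ embeds in $A$ over $K$ and $[L:K] = \deg(A)$ (by the condition on $H$, $E$ is then the Galois closure of $L/K$). Suppose that (i) $g_1,\dots,g_s \in G$ generate $G$ over $H$, i.e., $G = \langle g_1,\dots,g_s, H\rangle$, and (ii) if $G$ is cyclic then $H \neq \{1\}$. Then \[ \operatorname{ed}(A) \le \sum_{i=1}^{s} [G : (H \cap H^{g_i})] - [G:H] + 1 . \] -/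

import Mathlib

open scoped TensorProduct

universe u v w

/-- `A` descends to the subfield `K₀` of `K`: there is a (finite-dimensional) central simple
`K₀`-algebra `A₀` with `A ≅ K ⊗ A₀` over `K`. As such an `A₀` embeds in `A`, it may be taken
in the universe of `A`. -/
def DescendsTo {k : Type w} {K : Type u} [Field k] [Field K] [Algebra k K]
    (A : Type v) [Ring A] [Algebra K A] (K₀ : IntermediateField k K) : Prop :=
  ∃ (A₀ : Type v) (_ : Ring A₀) (_ : Algebra K₀ A₀),
    Algebra.IsCentral K₀ A₀ ∧ IsSimpleRing A₀ ∧ FiniteDimensional K₀ A₀ ∧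
      Nonempty (K ⊗[K₀] A₀ ≃ₐ[K] A)

/-- The essential dimension over `k` of a central simple `K`-algebra `A`: the least transcendence
degree over `k` of a field `k ⊆ K₀ ⊆ K` to which `A` descends. Cardinals are well ordered and
`A` descends to `K` itself, so the infimum is a minimum. -/
noncomputable def essentialDim (k : Type w) (K : Type u) [Field k] [Field K] [Algebra k K]
    (A : Type v) [Ring A] [Algebra K A] : Cardinal.{u} :=
  sInf {d | ∃ K₀ : IntermediateField k K, DescendsTo A K₀ ∧ d = Algebra.trdeg k K₀}

/-- The central simple `K`-algebra `A` is a `G/H`-crossed product: there is a finite Galois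
extension `E/K` with an identification `Gal(E/K) ≃ G`, such that the fixed field `L = E^H`
embeds in `A` over `K`, with `[L : K] = deg A`, and `H` has trivial core in `G`. (The last
condition says that `E` is the Galois closure of `L` over `K`.) -/
def IsCrossedProduct (K : Type u) [Field K] (A : Type v) [Ring A] [Algebra K A]
    {G : Type w} [Group G] (H : Subgroup G) : Prop :=
  H.normalCore = ⊥ ∧
  ∃ (E : Type u) (_ : Field E) (_ : Algebra K E),
    FiniteDimensional K E ∧ IsGalois K E ∧
    ∃ e : Gal(E/K) ≃* G,
      Nonempty (IntermediateField.fixedField (H.comap e.toMonoidHom) →ₐ[K] A) ∧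
      Module.finrank K (IntermediateField.fixedField (H.comap e.toMonoidHom)) ^ 2 =
        Module.finrank K A

/-- The conjugate `H^g = g H g⁻¹`. -/
def conjSubgroup {G : Type w} [Group G] (H : Subgroup G) (g : G) : Subgroup G :=
  H.map (MulAut.conj g).toMonoidHom

/-! ### Central simple algebras under scalar extension -/

section Simple

variable {K E A : Type*} [Field K] [Field E] [Ring A] [Algebra K E] [Algebra K A]

/-! Over `E` the algebra becomes a matrix algebra whose diagonal idempotents, coming from `L ⊆ A`,
are indexed by `G/H` and permuted by the Galois group. It therefore has matrix units `x v w` that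
each `σ` permutes up to scalars `s σ v w`. Descending `A` amounts to rescaling them until those
scalars lie in a small Galois-stable field `E₀`.

Take the graph with vertices `G/H` and edges the cosets of `H ∩ H^{g_i}`; it is connected because
the `g_i` generate `G` over `H`. Averaging over edge stabilizers gives equivariant nonzero elements
`τ ε • x (tgt ε) (src ε)`, one for each edge. Rescaling the matrix units by the values of `τ` along
paths turns the scalars into values of `τ` on cycles (`descendsTo_cycleField`). These values
generate `E₀`, whose transcendence degree is at most the rank of the cycle lattice, which is at most
edges - vertices + 1.

If Galois acts faithfully on `E₀`, then `A` descends to `E₀ ∩ K` (`descendsTo_comap`). A generic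
equivariant twist of `τ` makes the action faithful once every nontrivial element moves some cycle. A
trace computation (`card_moved_eq`) shows that the latter can fail only for a graph of out-degree
one, which means `G` cyclic and `H` trivial: the excluded case. -/

theorem equivFinsuppOfBasisLeft_includeRight_mul {ι : Type*} [DecidableEq ι]
    (b : Module.Basis ι K E) (a : A) (t : E ⊗[K] A) (i : ι) :
    TensorProduct.equivFinsuppOfBasisLeft b ((1 ⊗ₜ a) * t) i =
      a * TensorProduct.equivFinsuppOfBasisLeft b t i := by
  induction t using TensorProduct.induction_on with
  | zero => simp
  | tmul x y => simp
  | add x y hx hy => simp [mul_add, hx, hy]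

theorem equivFinsuppOfBasisLeft_mul_includeRight {ι : Type*} [DecidableEq ι]
    (b : Module.Basis ι K E) (a : A) (t : E ⊗[K] A) (i : ι) :
    TensorProduct.equivFinsuppOfBasisLeft b (t * (1 ⊗ₜ a)) i =
      TensorProduct.equivFinsuppOfBasisLeft b t i * a := by
  induction t using TensorProduct.induction_on with
  | zero => simp
  | tmul x y => simp
  | add x y hx hy => simp [add_mul, hx, hy]

/-- The scalar extension of a central simple algebra is simple. -/
theorem isSimpleRing_baseChange (K E A : Type*) [Field K] [Field E] [Ring A] [Algebra K E]
    [Algebra K A] [Algebra.IsCentral K A] [IsSimpleRing A] : IsSimpleRing (E ⊗[K] A) := by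
  classical
  have : Nontrivial A := inferInstance
  refine IsSimpleRing.of_eq_bot_or_eq_top fun I => or_iff_not_imp_left.2 fun hI => ?_
  let b := Module.Basis.ofVectorSpace K E
  let c := TensorProduct.equivFinsuppOfBasisLeft (N := A) b
  obtain ⟨t₁, ht₁, ht₁0⟩ : ∃ t ∈ I, t ≠ 0 := by
    by_contra! h
    exact hI (eq_bot_iff.2 fun x hx => by simpa using h x hx)
  -- Take a nonzero element of `I` with the fewest nonzero coordinates along `b`.
  obtain ⟨t, ⟨ht, ht0⟩, hmin⟩ := WellFounded.has_min
    (measure fun t : E ⊗[K] A => (c t).support.card).wf {t | t ∈ I ∧ t ≠ 0} ⟨t₁, ht₁, ht₁0⟩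
  replace hmin : ∀ w ∈ I, (c w).support ⊂ (c t).support → w = 0 := by
    intro w hw hlt
    by_contra hw0
    exact hmin w ⟨hw, hw0⟩ (Finset.card_lt_card hlt)
  have hct : c t ≠ 0 := by simpa using ht0
  obtain ⟨i₀, hi₀⟩ := Finsupp.support_nonempty_iff.2 hct
  -- The possible `i₀`-coordinates form a nonzero two-sided ideal of `A`, so `t` can be replaced by
  -- an element `u` whose `i₀`-coordinate is `1`.
  let J : TwoSidedIdeal A := TwoSidedIdeal.mk'
    {a | ∃ u ∈ I, (c u).support ⊆ (c t).support ∧ c u i₀ = a}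
    ⟨0, I.zero_mem, by simp, by simp⟩
    (by
      rintro _ _ ⟨x, hx, hx', rfl⟩ ⟨y, hy, hy', rfl⟩
      refine ⟨x + y, I.add_mem hx hy, ?_, by simp⟩
      rw [map_add]
      exact Finsupp.support_add.trans (Finset.union_subset hx' hy'))
    (by
      rintro _ ⟨x, hx, hx', rfl⟩
      exact ⟨-x, I.neg_mem hx, by simpa using hx', by simp⟩)
    (by
      rintro a _ ⟨x, hx, hx', rfl⟩
      refine ⟨(1 ⊗ₜ a) * x, I.mul_mem_left _ _ hx, fun i hi => hx' ?_,
        equivFinsuppOfBasisLeft_includeRight_mul b a x i₀⟩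
      rw [Finsupp.mem_support_iff] at hi ⊢
      intro h
      exact hi (by rw [equivFinsuppOfBasisLeft_includeRight_mul]; simp [c] at h; simp [h]))
    (by
      rintro _ a ⟨x, hx, hx', rfl⟩
      refine ⟨x * (1 ⊗ₜ a), I.mul_mem_right _ _ hx, fun i hi => hx' ?_,
        equivFinsuppOfBasisLeft_mul_includeRight b a x i₀⟩
      rw [Finsupp.mem_support_iff] at hi ⊢
      intro h
      exact hi (by rw [equivFinsuppOfBasisLeft_mul_includeRight]; simp [c] at h; simp [h]))
  have hJ : (1 : A) ∈ J := by
    refine IsSimpleRing.one_mem_of_ne_zero_mem J (x := c t i₀) (Finsupp.mem_support_iff.1 hi₀) ?_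
    simp only [J, TwoSidedIdeal.mem_mk']
    exact ⟨t, ht, subset_rfl, rfl⟩
  simp only [J, TwoSidedIdeal.mem_mk'] at hJ
  obtain ⟨u, hu, hus, hu1⟩ := hJ
  -- The commutator loses the coordinate `i₀`, so minimality kills it. Hence all coordinates of `u`
  -- are central, and `u` is a unit of the form `x ⊗ 1`.
  have hcomm : ∀ a : A, (1 ⊗ₜ a) * u - u * (1 ⊗ₜ a) = 0 := by
    intro a
    have hval : ∀ i, c ((1 ⊗ₜ a) * u - u * (1 ⊗ₜ a)) i = a * c u i - c u i * a := by
      intro i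
      rw [map_sub, Finsupp.sub_apply, equivFinsuppOfBasisLeft_includeRight_mul,
        equivFinsuppOfBasisLeft_mul_includeRight]
    refine hmin _ (I.sub_mem (I.mul_mem_left _ _ hu) (I.mul_mem_right _ _ hu)) ?_
    refine Finset.ssubset_iff_subset_ne.2 ⟨fun i hi => hus ?_, fun h => ?_⟩
    · rw [Finsupp.mem_support_iff, hval] at hi
      rw [Finsupp.mem_support_iff]
      intro h0
      simp [h0] at hi
    · rw [← h, Finsupp.mem_support_iff, hval, hu1] at hi₀
      simp at hi₀
  have hcen : ∀ i, ∃ r : K, algebraMap K A r = c u i := by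
    intro i
    have : c u i ∈ Subalgebra.center K A := by
      rw [Subalgebra.mem_center_iff]
      intro a
      have := congrArg (fun z => c z i) (hcomm a)
      rw [map_sub, Finsupp.sub_apply, equivFinsuppOfBasisLeft_includeRight_mul,
        equivFinsuppOfBasisLeft_mul_includeRight] at this
      simpa [sub_eq_zero] using this
    simpa [Algebra.IsCentral.center_eq_bot, Algebra.mem_bot] using this
  choose r hr using hcen
  let ρ : _ →₀ K := Finsupp.onFinset (c u).support r (fun i hi => by
    rw [Finsupp.mem_support_iff, ← hr]; simpa using hi)
  have hux : u = (b.repr.symm ρ) ⊗ₜ 1 := by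
    apply c.injective
    ext i
    rw [TensorProduct.equivFinsuppOfBasisLeft_apply_tmul_apply, LinearEquiv.apply_symm_apply,
      ← hr i, Algebra.algebraMap_eq_smul_one]
    rfl
  have hx0 : b.repr.symm ρ ≠ 0 := by
    intro h
    rw [h, TensorProduct.zero_tmul] at hux
    simp [hux] at hu1
  rw [← TwoSidedIdeal.one_mem_iff]
  have := I.mul_mem_left ((b.repr.symm ρ)⁻¹ ⊗ₜ 1) _ hu
  rw [hux, Algebra.TensorProduct.tmul_mul_tmul, inv_mul_cancel₀ hx0, one_mul] at this
  exact this

/-- A simple ring is prime. -/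
theorem exists_mul_mul_ne_zero {R : Type*} [Ring R] [IsSimpleRing R] {x y : R} (hx : x ≠ 0)
    (hy : y ≠ 0) : ∃ r, x * r * y ≠ 0 := by
  by_contra! h
  let I : TwoSidedIdeal R := TwoSidedIdeal.mk' {z | ∀ r, x * r * z = 0}
    (by simp) (fun ha hb r => by rw [mul_add, ha r, hb r, add_zero])
    (fun ha r => by rw [mul_neg, ha r, neg_zero])
    (fun {a b} ha r => by rw [← mul_assoc, mul_assoc x, ha])
    (fun {a b} ha r => by rw [← mul_assoc, ha, zero_mul])
  have hI : (1 : R) ∈ I := IsSimpleRing.one_mem_of_ne_zero_mem I hy (by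
    simp only [I, TwoSidedIdeal.mem_mk']; exact h)
  simp only [I, TwoSidedIdeal.mem_mk'] at hI
  exact hx (by simpa using hI 1)

/-- An algebra is simple if a scalar extension is. -/
theorem IsSimpleRing.of_baseChange (F K A : Type*) [Field F] [Field K] [Ring A] [Algebra F K]
    [Algebra F A] [IsSimpleRing (K ⊗[F] A)] : IsSimpleRing A := by
  have : Nontrivial (K ⊗[F] A) := inferInstance
  have : Nontrivial A := by
    by_contra h
    rw [not_nontrivial_iff_subsingleton] at h
    exact not_subsingleton (K ⊗[F] A) inferInstance
  refine IsSimpleRing.of_eq_bot_or_eq_top fun I => ?_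
  let q : A →ₐ[F] I.ringCon.Quotient := { I.ringCon.mk' with commutes' := fun _ => rfl }
  have hq : ∀ x, q x = 0 ↔ x ∈ I := fun x => by
    rw [TwoSidedIdeal.mem_iff, ← RingCon.eq]; rfl
  rcases IsSimpleRing.injective_ringHom_or_subsingleton_codomain
    (Algebra.TensorProduct.map (AlgHom.id F K) q).toRingHom with h | h
  · left
    refine eq_bot_iff.2 fun x hx => ?_
    rw [TwoSidedIdeal.mem_bot]
    have : (1 : K) ⊗ₜ[F] x = 0 := h (by simp [(hq x).2 hx])
    exact Algebra.TensorProduct.includeRight_injective (A := K) (B := A) (R := F)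
      (algebraMap F K).injective (by simpa using this)
  · right
    rw [← TwoSidedIdeal.one_mem_iff, ← hq]
    by_contra hne
    have : Nontrivial I.ringCon.Quotient := ⟨_, _, hne⟩
    exact not_subsingleton (K ⊗[F] I.ringCon.Quotient) h

/-- For `x` central, `1 ⊗ x` is central and hence a scalar `r ∈ K`; an `F`-linear retraction `g : K
→ F` applied to the left factor gives `x = g r`. -/
theorem Algebra.IsCentral.of_baseChange (F K A : Type*) [Field F] [Field K] [Ring A] [Algebra F K]
    [Algebra F A] [Algebra.IsCentral K (K ⊗[F] A)] : Algebra.IsCentral F A := by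
  classical
  refine ⟨fun x hx => ?_⟩
  have h1 : (1 : K) ⊗ₜ[F] x ∈ Subalgebra.center K (K ⊗[F] A) := by
    rw [Subalgebra.mem_center_iff] at hx ⊢
    intro t
    induction t using TensorProduct.induction_on with
    | zero => simp
    | tmul a y => simp [hx y]
    | add a y ha hy => simp [add_mul, mul_add, ha, hy]
  rw [Algebra.IsCentral.center_eq_bot, Algebra.mem_bot] at h1
  obtain ⟨r, hr⟩ := h1
  obtain ⟨g, hg⟩ := LinearMap.exists_leftInverse_of_injective (Algebra.linearMap F K)
    (LinearMap.ker_eq_bot.2 (algebraMap F K).injective)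
  have hg1 : g 1 = 1 := by simpa using LinearMap.congr_fun hg 1
  have h2 := congrArg (fun t => TensorProduct.lid F A (g.rTensor A t)) hr
  rw [Algebra.mem_bot]
  refine ⟨g r, ?_⟩
  rw [Algebra.TensorProduct.algebraMap_apply] at h2
  simpa [hg1, Algebra.algebraMap_eq_smul_one] using h2

/-- The multiplication map `K ⊗ A₀ → A` of a subalgebra `A₀` over a subfield of `K`. -/
noncomputable def subalgebraMulMap {k K A : Type*} [Field k] [Field K] [Algebra k K] [Ring A]
    [Algebra K A] {K₀ : IntermediateField k K} (A₀ : Subalgebra K₀ A) : K ⊗[K₀] A₀ →ₐ[K] A :=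
  Algebra.TensorProduct.lift (Algebra.ofId K A) A₀.val fun r a => by
    rw [Algebra.ofId_apply]
    exact Algebra.commute_algebraMap_left r _

theorem subalgebraMulMap_tmul {k K A : Type*} [Field k] [Field K] [Algebra k K] [Ring A]
    [Algebra K A] {K₀ : IntermediateField k K} (A₀ : Subalgebra K₀ A) (r : K) (a : A₀) :
    subalgebraMulMap A₀ (r ⊗ₜ a) = r • (a : A) := by
  rw [subalgebraMulMap, Algebra.TensorProduct.lift_tmul, Algebra.ofId_apply, Algebra.smul_def]
  rfl

/-- `A` descends to `K₀` as soon as some `K₀`-subalgebra is a `K₀`-form of it. -/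
theorem DescendsTo.of_bijective {k : Type w} {K : Type u} [Field k] [Field K] [Algebra k K]
    {A : Type v} [Ring A] [Algebra K A] [Algebra.IsCentral K A] [IsSimpleRing A]
    [FiniteDimensional K A] {K₀ : IntermediateField k K} (A₀ : Subalgebra K₀ A)
    (h : Function.Bijective (subalgebraMulMap A₀)) : DescendsTo A K₀ := by
  let e : K ⊗[K₀] A₀ ≃ₐ[K] A := AlgEquiv.ofBijective _ h
  have : IsSimpleRing (K ⊗[K₀] A₀) := IsSimpleRing.of_ringEquiv e.symm.toRingEquiv inferInstance
  have : Algebra.IsCentral K (K ⊗[K₀] A₀) := ⟨fun x hx => by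
    have hex : e x ∈ Subalgebra.center K A := by
      rw [Subalgebra.mem_center_iff] at hx ⊢
      intro y
      have := congrArg e (hx (e.symm y))
      simpa using this
    rw [Algebra.IsCentral.center_eq_bot, Algebra.mem_bot] at hex
    obtain ⟨r, hr⟩ := hex
    exact Algebra.mem_bot.2 ⟨r, e.injective (by rw [← hr, e.commutes])⟩⟩
  refine ⟨A₀, inferInstance, inferInstance, Algebra.IsCentral.of_baseChange K₀ K A₀,
    IsSimpleRing.of_baseChange K₀ K A₀, ?_, ⟨e⟩⟩
  have hfin : Module.rank K (K ⊗[K₀] A₀) < Cardinal.aleph0 := by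
    have : Module.Finite K (K ⊗[K₀] A₀) := Module.Finite.equiv e.symm.toLinearEquiv
    exact Module.rank_lt_aleph0 _ _
  rw [Module.rank_baseChange, Cardinal.lift_lt_aleph0] at hfin
  exact Module.rank_lt_aleph0_iff.1 hfin

end Simple

/-! ### Independence of characters and equivariant choices -/

/-- Dedekind's independence of characters, with vectors as coefficients. -/
theorem eq_zero_of_forall_sum_monoidHom_smul {F E W ι : Type*} [MulOneClass F] [Field E]
    [AddCommGroup W] [Module E W] [Fintype ι] {f : ι → F →* E} (hf : Function.Injective f)
    {x : ι → W} (h : ∀ a, ∑ i, f i a • x i = 0) (i : ι) : x i = 0 := by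
  rw [← Module.forall_dual_apply_eq_zero_iff E]
  intro l
  have hli := (linearIndependent_monoidHom F E).comp f hf
  rw [Fintype.linearIndependent_iff] at hli
  refine hli (fun i => l (x i)) ?_ i
  ext a
  have := congrArg l (h a)
  simpa [mul_comm] using this

/-- An equivariant choice from a family of sets exists if each set has a point fixed by the
stabilizer of its index. -/
theorem exists_equivariant_choice {Γ X Y : Type*} [Group Γ] [MulAction Γ X] [MulAction Γ Y]
    {T : X → Set Y} (hT : ∀ (σ : Γ) x, ∀ y ∈ T x, σ • y ∈ T (σ • x))
    (h : ∀ x, ∃ y ∈ T x, ∀ σ ∈ MulAction.stabilizer Γ x, σ • y = y) :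
    ∃ f : X → Y, (∀ x, f x ∈ T x) ∧ ∀ (σ : Γ) x, f (σ • x) = σ • f x := by
  choose y hy hfix using h
  let rep : X → X := fun x => (Quotient.mk (MulAction.orbitRel Γ X) x).out
  have hrep : ∀ x, ∃ σ : Γ, σ • rep x = x := fun x =>
    MulAction.orbitRel_apply.1 ((MulAction.orbitRel Γ X).symm
      (Quotient.mk_out (s := MulAction.orbitRel Γ X) x))
  have hrep_smul : ∀ (σ : Γ) x, rep (σ • x) = rep x := fun σ x =>
    congrArg Quotient.out (Quotient.sound (s := MulAction.orbitRel Γ X)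
      (MulAction.orbitRel_apply.2 (MulAction.mem_orbit x σ)))
  choose τ hτ using hrep
  refine ⟨fun x => τ x • y (rep x), fun x => ?_, fun σ x => ?_⟩
  · have := hT (τ x) _ _ (hy (rep x))
    rwa [hτ] at this
  · have h1 : ((τ (σ • x))⁻¹ * (σ * τ x)) • y (rep x) = y (rep x) := by
      apply hfix
      rw [MulAction.mem_stabilizer_iff, mul_smul, mul_smul, hτ, inv_smul_eq_iff]
      conv_rhs => rw [← hrep_smul σ x, hτ]
    simp only [hrep_smul]
    rw [mul_smul, inv_smul_eq_iff, mul_smul] at h1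
    exact h1.symm

/-! ### Galois sets inside the extension field -/

section Galois

variable {K E : Type*} [Field K] [Field E] [Algebra K E] [FiniteDimensional K E] [IsGalois K E]

/-- An automorphism fixing a generator fixes the whole fixed field, so the stabilizer of the
generator is `S` and its conjugates are indexed by the cosets of `S`. -/
theorem smul_powerBasis_gen_eq_iff (S : Subgroup Gal(E/K)) (σ τ : Gal(E/K)) :
    σ • ((Field.powerBasisOfFiniteOfSeparable K (IntermediateField.fixedField S)).gen : E) =
      τ • ((Field.powerBasisOfFiniteOfSeparable K (IntermediateField.fixedField S)).gen : E) ↔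
    τ⁻¹ * σ ∈ S := by
  have key : ∀ ρ : Gal(E/K),
      ρ • ((Field.powerBasisOfFiniteOfSeparable K (IntermediateField.fixedField S)).gen : E) =
      ((Field.powerBasisOfFiniteOfSeparable K (IntermediateField.fixedField S)).gen : E) ↔
      ρ ∈ S := by
    intro ρ
    constructor
    · intro h
      rw [← IntermediateField.fixingSubgroup_fixedField S, IntermediateField.mem_fixingSubgroup_iff]
      have := PowerBasis.algHom_ext
        (Field.powerBasisOfFiniteOfSeparable K (IntermediateField.fixedField S))
        (f := (ρ : E →ₐ[K] E).comp (IntermediateField.fixedField S).val)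
        (g := (IntermediateField.fixedField S).val) h
      exact fun x hx => DFunLike.congr_fun this ⟨x, hx⟩
    · intro h
      exact (Field.powerBasisOfFiniteOfSeparable K (IntermediateField.fixedField S)).gen.2 ⟨ρ, h⟩
  rw [← key, mul_smul, inv_smul_eq_iff]

theorem exists_stabilizer_eq (S : Subgroup Gal(E/K)) :
    ∃ θ : E, MulAction.stabilizer Gal(E/K) θ = S := by
  refine ⟨(Field.powerBasisOfFiniteOfSeparable K (IntermediateField.fixedField S)).gen, ?_⟩
  ext σ
  have := smul_powerBasis_gen_eq_iff S σ 1
  rw [one_smul, inv_one, one_mul] at this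
  rw [MulAction.mem_stabilizer_iff, this]

/-- Every finite `Gal(E/K)`-set embeds equivariantly in `E`, if `K` is infinite. -/
theorem exists_equivariant_injective [Infinite K] (X : Type*) [Finite X]
    [MulAction Gal(E/K) X] :
    ∃ η : X → E, Function.Injective η ∧ ∀ (σ : Gal(E/K)) x, η (σ • x) = σ • η x := by
  classical
  -- The equivariant maps form a `K`-space, and those identifying two given distinct points form a
  -- proper subspace. Finitely many proper subspaces cannot cover it, since `K` is infinite.
  let W : Submodule K (X → E) :=
    { carrier := {η | ∀ (σ : Gal(E/K)) x, η (σ • x) = σ • η x}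
      add_mem' := fun ha hb σ x => by simp [ha σ x, hb σ x, smul_add]
      zero_mem' := fun σ x => by simp
      smul_mem' := fun c η h σ x => by simp [h σ x, smul_comm σ c] }
  let D : X × X → Submodule K W := fun p =>
    LinearMap.ker (((LinearMap.proj p.1 : (X → E) →ₗ[K] E) - LinearMap.proj p.2) ∘ₗ W.subtype)
  have hD : ∀ p : X × X, p.1 ≠ p.2 → D p ≠ ⊤ := by
    rintro ⟨x, y⟩ hxy htop
    simp only at hxy
    have hall : ∀ η ∈ W, η x = η y := fun η hη => by
      have : (⟨η, hη⟩ : W) ∈ D (x, y) := htop ▸ Submodule.mem_top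
      simpa [D, sub_eq_zero] using this
    -- Points of one orbit are separated by a map preserving stabilizers exactly, points of
    -- different orbits by the indicator function of an orbit.
    by_cases hor : y ∈ MulAction.orbit Gal(E/K) x
    · obtain ⟨η, hη, heq⟩ := exists_equivariant_choice (Γ := Gal(E/K)) (X := X) (Y := E)
        (T := fun x => {θ | MulAction.stabilizer Gal(E/K) θ = MulAction.stabilizer Gal(E/K) x})
        (fun σ x θ hθ => by
          rw [Set.mem_ofPred_eq] at hθ ⊢
          rw [MulAction.stabilizer_smul_eq_stabilizer_map_conj, hθ,
            ← MulAction.stabilizer_smul_eq_stabilizer_map_conj])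
        (fun x => by
          obtain ⟨θ, hθ⟩ := exists_stabilizer_eq (K := K) (MulAction.stabilizer Gal(E/K) x)
          exact ⟨θ, hθ, fun σ hσ => by rwa [← hθ] at hσ⟩)
      obtain ⟨σ, rfl⟩ := hor
      have h1 := hall η heq
      rw [heq] at h1
      have : σ ∈ MulAction.stabilizer Gal(E/K) (η x) := h1.symm
      rw [hη x] at this
      exact hxy (MulAction.mem_stabilizer_iff.1 this).symm
    · have := hall (fun z => if z ∈ MulAction.orbit Gal(E/K) x then 1 else 0) (fun σ z => by
        have : σ • z ∈ MulAction.orbit Gal(E/K) x ↔ z ∈ MulAction.orbit Gal(E/K) x :=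
          ⟨fun h => by simpa using MulAction.mem_orbit_of_mem_orbit σ⁻¹ h,
            MulAction.mem_orbit_of_mem_orbit σ⟩
        simp only [this]
        split_ifs <;> simp)
      simp [hor] at this
  have := Fintype.ofFinite X
  have hcover := Subspace.biUnion_ne_univ_of_top_notMem (k := K) (E := W)
    (s := (Finset.univ.filter fun p : X × X => p.1 ≠ p.2).image D) (by
      simp only [Finset.mem_image, Finset.mem_filter, Finset.mem_univ, true_and, not_exists, not_and]
      exact fun p hp => hD p hp)
  obtain ⟨η, hη⟩ := (Set.ne_univ_iff_exists_notMem _).1 hcover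
  refine ⟨η, fun x y hxy => ?_, η.2⟩
  by_contra hne
  refine hη (Set.mem_biUnion (x := D (x, y)) (by simpa using ⟨x, y, hne, rfl⟩) ?_)
  simp [D, hxy]

end Galois

/-! ### Cycles of a graph with group action -/

section Graph

variable {Γ V X : Type*} [Group Γ] [MulAction Γ V] [MulAction Γ X]

/-- The boundary map of a directed graph with vertices `V` and edges `X`. -/
noncomputable def boundary (src tgt : X → V) : (X →₀ ℤ) →ₗ[ℤ] (V →₀ ℤ) :=
  Finsupp.linearCombination ℤ fun x => Finsupp.single (tgt x) 1 - Finsupp.single (src x) 1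

/-- The action of a group element on the chains of a set. -/
noncomputable def chainMap (X : Type*) [MulAction Γ X] (σ : Γ) : (X →₀ ℤ) →ₗ[ℤ] (X →₀ ℤ) :=
  Finsupp.lmapDomain ℤ ℤ (σ • ·)

@[simp] theorem boundary_single (src tgt : X → V) (x : X) :
    boundary src tgt (Finsupp.single x 1) =
      Finsupp.single (tgt x) 1 - Finsupp.single (src x) 1 := by
  simp [boundary]

@[simp] theorem chainMap_single (σ : Γ) (x : X) :
    chainMap X σ (Finsupp.single x 1) = Finsupp.single (σ • x) 1 := by
  simp [chainMap]

theorem boundary_chainMap {src tgt : X → V} (hsrc : ∀ (σ : Γ) x, src (σ • x) = σ • src x)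
    (htgt : ∀ (σ : Γ) x, tgt (σ • x) = σ • tgt x) (σ : Γ) (p : X →₀ ℤ) :
    boundary src tgt (chainMap X σ p) = chainMap V σ (boundary src tgt p) := by
  have : boundary src tgt ∘ₗ chainMap X σ = chainMap V σ ∘ₗ boundary src tgt := by
    ext x : 2
    simp [hsrc, htgt]
  exact LinearMap.congr_fun this p

/-- The cycle space of a connected graph has rank at most `|X| - |V| + 1`. -/
theorem finrank_ker_boundary_le [Fintype V] [Fintype X] {src tgt : X → V} {v₀ : V}
    (hconn : ∀ v, Finsupp.single v 1 - Finsupp.single v₀ 1 ∈ LinearMap.range (boundary src tgt)) :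
    Module.finrank ℤ (LinearMap.ker (boundary src tgt)) + Fintype.card V ≤ Fintype.card X + 1 := by
  have h1 := Submodule.finrank_quotient_add_finrank (LinearMap.ker (boundary src tgt))
  rw [(boundary src tgt).quotKerEquivRange.finrank_eq, Module.finrank_finsupp_self] at h1
  let f : (LinearMap.range (boundary src tgt)) × ℤ →ₗ[ℤ] (V →₀ ℤ) :=
    LinearMap.coprod (Submodule.subtype _) (LinearMap.toSpanSingleton ℤ _ (Finsupp.single v₀ 1))
  have hf : LinearMap.range f = ⊤ := by
    rw [eq_top_iff, ← (Finsupp.basisSingleOne (R := ℤ) (ι := V)).span_eq, Submodule.span_le]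
    rintro _ ⟨v, rfl⟩
    exact ⟨(⟨_, hconn v⟩, 1), by simp [f]⟩
  have h2 := LinearMap.finrank_le_finrank_of_surjective (LinearMap.range_eq_top.1 hf)
  rw [Module.finrank_finsupp_self, Module.finrank_prod, Module.finrank_self] at h2
  omega

/-- With `ψ` extended linearly to chains, this is `tr(∂ψ) = tr(ψ∂)`. -/
theorem sum_boundary_apply_self [Fintype V] [Fintype X] (src tgt : X → V)
    (ψ : V → X →₀ ℤ) :
    ∑ v, boundary src tgt (ψ v) v = ∑ x, (ψ (tgt x) x - ψ (src x) x) := by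
  classical
  have : ∀ v, boundary src tgt (ψ v) v =
      ∑ x, ((if tgt x = v then ψ v x else 0) - (if src x = v then ψ v x else 0)) := by
    intro v
    rw [boundary, Finsupp.linearCombination_apply, Finsupp.sum_fintype _ _ (by simp),
      Finsupp.finsetSum_apply]
    refine Finset.sum_congr rfl fun x _ => ?_
    simp [Finsupp.single_apply, mul_sub]
  simp only [this]
  rw [Finset.sum_comm]
  refine Finset.sum_congr rfl fun x _ => ?_
  rw [Finset.sum_sub_distrib]
  simp

/-- If an automorphism of a connected graph fixes all cycles, then it moves as many edges as it
moves vertices. -/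
theorem card_moved_eq [Fintype V] [Fintype X] [DecidableEq V] [DecidableEq X] {src tgt : X → V}
    {v₀ : V} (hsrc : ∀ (σ : Γ) x, src (σ • x) = σ • src x)
    (htgt : ∀ (σ : Γ) x, tgt (σ • x) = σ • tgt x)
    (hconn : ∀ v, Finsupp.single v 1 - Finsupp.single v₀ 1 ∈ LinearMap.range (boundary src tgt))
    {σ : Γ} (hσ : ∀ p ∈ LinearMap.ker (boundary src tgt), chainMap X σ p = p) :
    (Finset.univ.filter fun x : X => σ • x ≠ x).card =
      (Finset.univ.filter fun v : V => σ • v ≠ v).card := by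
  choose p hp using hconn
  -- Here `p v` is a path from `v₀` to `v` and `ψ = (σ - 1)p`. On vertices the trace is minus the
  -- number moved, the terms from `v₀` cancelling. On edges, `p (tgt x) - p (src x) - x` is a cycle,
  -- so `ψ∂x = σx - x`, and the trace is minus the number of edges moved.
  have key := sum_boundary_apply_self src tgt (fun v => chainMap X σ (p v) - p v)
  have h1 : ∀ v, boundary src tgt (chainMap X σ (p v) - p v) v =
      (if σ • v ≠ v then -1 else 0) + ((if v₀ = v then 1 else 0) -
        (if σ • v₀ = v then 1 else 0)) := by
    intro v
    rw [map_sub, boundary_chainMap hsrc htgt, hp]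
    simp [Finsupp.single_apply]
    split_ifs <;> simp_all
  have h2 : ∀ x, (chainMap X σ (p (tgt x)) - p (tgt x)) x -
      (chainMap X σ (p (src x)) - p (src x)) x = if σ • x ≠ x then -1 else 0 := by
    intro x
    have := hσ (p (tgt x) - p (src x) - Finsupp.single x 1) (by
      simp [hp])
    have h3 := DFunLike.congr_fun this x
    simp [Finsupp.single_apply] at h3 ⊢
    split_ifs at h3 ⊢ <;> linarith
  simp only [h1, h2] at key
  rw [Finset.sum_add_distrib, Finset.sum_sub_distrib] at key
  simp only [Finset.sum_ite_eq, Finset.mem_univ, if_true, sub_self, add_zero] at key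
  rw [← Finset.sum_filter, ← Finset.sum_filter] at key
  simp at key
  exact_mod_cast key.symm

/-- If some group element moves a vertex of a connected vertex-transitive graph but fixes all its
cycles, then every vertex is the source of a single edge. -/
theorem src_injective_of_fixes_cycles [Finite V] [Finite X] [MulAction.IsPretransitive Γ V]
    {src tgt : X → V} {v₀ : V} (hsrc : ∀ (σ : Γ) x, src (σ • x) = σ • src x)
    (htgt : ∀ (σ : Γ) x, tgt (σ • x) = σ • tgt x) (hsurj : Function.Surjective src)
    (hconn : ∀ v, Finsupp.single v 1 - Finsupp.single v₀ 1 ∈ LinearMap.range (boundary src tgt))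
    {σ : Γ} (hσ : ∀ p ∈ LinearMap.ker (boundary src tgt), chainMap X σ p = p)
    {v : V} (hv : σ • v ≠ v) : Function.Injective src := by
  classical
  have := Fintype.ofFinite V
  have := Fintype.ofFinite X
  have hcard := card_moved_eq hsrc htgt hconn hσ
  -- Edges with moved source are moved, and their sources exhaust the moved vertices; equality of
  -- the two counts makes `src` injective on them.
  have hinj : Set.InjOn src (Finset.univ.filter fun x : X => σ • src x ≠ src x) := by
    apply Finset.injOn_of_card_image_eq
    apply le_antisymm Finset.card_image_le
    have himg : (Finset.univ.filter fun x : X => σ • src x ≠ src x).image src =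
        Finset.univ.filter fun v : V => σ • v ≠ v := by
      ext w
      simp only [Finset.mem_image, Finset.mem_filter, Finset.mem_univ, true_and]
      constructor
      · rintro ⟨x, hx, rfl⟩
        exact hx
      · intro hw
        obtain ⟨x, rfl⟩ := hsurj w
        exact ⟨x, hw, rfl⟩
    rw [himg, ← hcard]
    refine Finset.card_le_card fun x hx => ?_
    simp only [Finset.mem_filter, Finset.mem_univ, true_and] at hx ⊢
    intro h
    exact hx (by rw [← hsrc, h])
  intro x y hxy
  obtain ⟨g, hg⟩ := MulAction.exists_smul_eq Γ (src x) v
  have := hinj (x₁ := g • x) (x₂ := g • y) (by simpa [hsrc, hg] using hv)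
    (by simpa [hsrc, ← hxy, hg] using hv) (by rw [hsrc, hsrc, hxy])
  exact MulAction.injective g this

end Graph

/-! ### Generic translates avoiding monomial relations -/

section Twist

variable {K E X : Type*} [Field K] [Field E] [Algebra K E]

-- After clearing denominators such `c` are roots of a polynomial `Q`. It is nonzero: if `p x₀ ≠ 0`,
-- exactly one of its two terms vanishes at `-η x₀`, because `η` is injective.
open Polynomial in
theorem finite_setOf_prod_zpow_eq_one [Fintype X] {η : X → E} (hη : Function.Injective η)
    {p : X → ℤ} (hp : p ≠ 0) {u : E} (hu : u ≠ 0) :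
    {c : K | (∀ x, algebraMap K E c + η x ≠ 0) ∧
      u * ∏ x, (algebraMap K E c + η x) ^ p x = 1}.Finite := by
  classical
  let Q : E[X] := C u * ∏ x, (Polynomial.X + C (η x)) ^ (p x).toNat -
    ∏ x, (Polynomial.X + C (η x)) ^ (-p x).toNat
  have hQ : Q ≠ 0 := by
    obtain ⟨x₀, hx₀⟩ := Function.ne_iff.1 hp
    intro h
    have hev : ∀ n : X → ℕ, eval (-η x₀) (∏ x, (Polynomial.X + C (η x)) ^ n x) = 0 ↔
        n x₀ ≠ 0 := by
      intro n
      rw [eval_prod, Finset.prod_eq_zero_iff]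
      constructor
      · rintro ⟨x, -, hx⟩
        simp only [eval_pow, eval_add, eval_X, eval_C] at hx
        have hx1 : n x ≠ 0 := by rintro h0; simp [h0] at hx
        have hx2 : -η x₀ + η x = 0 := (pow_eq_zero_iff hx1).1 hx
        have : x = x₀ := hη (by linear_combination hx2)
        rwa [← this]
      · intro hn
        exact ⟨x₀, Finset.mem_univ _, by simp [hn]⟩
    have h1 := congrArg (eval (-η x₀)) h
    simp only [Q, eval_sub, eval_mul, eval_C, eval_zero, sub_eq_zero] at h1
    have h2 := hev fun x => (p x).toNat
    have h3 := hev fun x => (-p x).toNat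
    have h4 : (p x₀).toNat ≠ 0 ↔ (-p x₀).toNat ≠ 0 := by
      rw [← h2, ← h3, ← h1, mul_eq_zero]
      simp [hu]
    simp only [Pi.zero_apply] at hx₀
    omega
  refine ((Q.roots.toFinset.finite_toSet).preimage
    ((algebraMap K E).injective.injOn)).subset ?_
  rintro c ⟨hc0, hc⟩
  simp only [Set.mem_preimage, Finset.mem_coe, Multiset.mem_toFinset, mem_roots hQ, IsRoot.def]
  have hz : ∀ x, (algebraMap K E c + η x) ^ p x =
      (algebraMap K E c + η x) ^ (p x).toNat / (algebraMap K E c + η x) ^ (-p x).toNat := by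
    intro x
    conv_lhs => rw [← Int.toNat_sub_toNat_neg (p x)]
    rw [zpow_sub₀ (hc0 x), zpow_natCast, zpow_natCast]
  simp only [hz, Finset.prod_div_distrib] at hc
  have hd : ∏ x, (algebraMap K E c + η x) ^ (-p x).toNat ≠ 0 :=
    Finset.prod_ne_zero_iff.2 fun x _ => pow_ne_zero _ (hc0 x)
  simp only [Q, eval_sub, eval_mul, eval_C, eval_prod, eval_pow, eval_add, eval_X, sub_eq_zero]
  field_simp at hc
  exact hc

/-- A generic translate of distinct elements satisfies none of finitely many given monomial
relations. -/
theorem exists_translate_prod_zpow_ne_one [Infinite K] [Fintype X] {ι : Type*} [Finite ι]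
    {η : X → E} (hη : Function.Injective η) {p : ι → X → ℤ} (hp : ∀ i, p i ≠ 0) {u : ι → E}
    (hu : ∀ i, u i ≠ 0) :
    ∃ c : K, (∀ x, algebraMap K E c + η x ≠ 0) ∧
      ∀ i, u i * ∏ x, (algebraMap K E c + η x) ^ p i x ≠ 1 := by
  have h1 : (⋃ x, {c : K | algebraMap K E c = -η x}).Finite :=
    Set.finite_iUnion fun x => Set.Subsingleton.finite fun a ha b hb =>
      (algebraMap K E).injective (ha.trans hb.symm)
  have h2 := Set.finite_iUnion fun i => finite_setOf_prod_zpow_eq_one (K := K) hη (hp i) (hu i)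
  obtain ⟨c, hc⟩ := (h1.union h2).infinite_compl.nonempty
  simp only [Set.mem_compl_iff, Set.mem_union, Set.mem_iUnion, not_or, not_exists] at hc
  have hc0 : ∀ x, algebraMap K E c + η x ≠ 0 := fun x h => hc.1 x (eq_neg_of_add_eq_zero_left h)
  exact ⟨c, hc0, fun i h => hc.2 i ⟨hc0, h⟩⟩

end Twist

/-! ### The semilinear Galois action on the scalar extension -/

section BaseChange

variable {K E A : Type*} [Field K] [Field E] [Ring A] [Algebra K E] [Algebra K A]

theorem gal_smul_mul (σ : Gal(E/K)) (x y : E ⊗[K] A) : σ • (x * y) = σ • x * σ • y := by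
  induction x using TensorProduct.induction_on with
  | zero => simp
  | add a b ha hb => simp [add_mul, smul_add, ha, hb]
  | tmul a b =>
    induction y using TensorProduct.induction_on with
    | zero => simp
    | add c d hc hd => simp [mul_add, smul_add, hc, hd]
    | tmul c d => simp [TensorProduct.smul_tmul']

theorem gal_smul_smul (σ : Gal(E/K)) (a : E) (x : E ⊗[K] A) : σ • (a • x) = σ a • σ • x := by
  induction x using TensorProduct.induction_on with
  | zero => simp
  | add a b ha hb => simp [smul_add, ha, hb]
  | tmul b c => simp [TensorProduct.smul_tmul']

theorem gal_smul_one_tmul (σ : Gal(E/K)) (a : A) :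
    σ • ((1 : E) ⊗ₜ[K] a) = (1 : E) ⊗ₜ[K] a := by
  simp [TensorProduct.smul_tmul']

/-- Coordinates along a `K`-basis of `A` are Galois-fixed elements of `E`, hence lie in `K`. -/
theorem exists_one_tmul_eq_of_fixed [FiniteDimensional K E] [IsGalois K E] {b : E ⊗[K] A}
    (hb : ∀ σ : Gal(E/K), σ • b = b) : ∃ a : A, (1 : E) ⊗ₜ[K] a = b := by
  classical
  let β := Module.Basis.ofVectorSpace K A
  let c := TensorProduct.equivFinsuppOfBasisRight (M := E) β
  have hc : ∀ (σ : Gal(E/K)) t i, c (σ • t) i = σ (c t i) := by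
    intro σ t i
    induction t using TensorProduct.induction_on with
    | zero => simp
    | add a b ha hb => rw [smul_add, map_add, Finsupp.add_apply, ha, hb, ← map_add,
        ← Finsupp.add_apply, ← map_add]
    | tmul a b => simp [c, TensorProduct.smul_tmul']
  have hK : ∀ i, ∃ r : K, algebraMap K E r = c b i := by
    intro i
    rw [← Set.mem_range, ← IntermediateField.mem_bot, IsGalois.mem_bot_iff_fixed]
    intro σ
    rw [← hc, hb]
  choose r hr using hK
  let ρ : _ →₀ K := Finsupp.onFinset (c b).support r (fun i hi => by
    rw [Finsupp.mem_support_iff, ← hr]; simpa using hi)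
  refine ⟨β.repr.symm ρ, ?_⟩
  apply c.injective
  ext i
  rw [TensorProduct.equivFinsuppOfBasisRight_apply_tmul_apply, LinearEquiv.apply_symm_apply,
    ← hr i, Algebra.algebraMap_eq_smul_one]
  rfl

open Polynomial in
theorem gal_smul_aeval_one_tmul (σ : Gal(E/K)) (a : A) (P : E[X]) :
    σ • aeval ((1 : E) ⊗ₜ[K] a) P = aeval ((1 : E) ⊗ₜ[K] a) (P.map (σ : E →+* E)) := by
  have hpow : ∀ n : ℕ, σ • ((1 : E) ⊗ₜ[K] a) ^ n = ((1 : E) ⊗ₜ[K] a) ^ n := fun n => by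
    rw [Algebra.TensorProduct.tmul_pow, one_pow, gal_smul_one_tmul]
  induction P using Polynomial.induction_on' with
  | add p q hp hq => rw [map_add, smul_add, hp, hq, Polynomial.map_add, map_add]
  | monomial n c =>
    rw [aeval_monomial, map_monomial, aeval_monomial, ← Algebra.smul_def, ← Algebra.smul_def,
      gal_smul_smul, hpow]
    rfl

end BaseChange

/-! ### Matrix units from orthogonal idempotents -/

section MatrixUnits

theorem mul_sum_smul_mul_of_corners {E B V : Type*} [Field E] [Ring B] [Algebra E B]
    [Fintype V] {e : V → B} (he : OrthogonalIdempotents e) {y : V → V → B}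
    (hl : ∀ v w, e v * y v w = y v w) (hr : ∀ v w, y v w * e w = y v w) (c : V × V → E) (v w : V) :
    e v * (∑ p, c p • y p.1 p.2) * e w = c (v, w) • y v w := by
  rw [Finset.mul_sum, Finset.sum_mul, Finset.sum_eq_single (v, w)]
  · simp [hl, hr]
  · rintro ⟨v', w'⟩ - hne'
    rw [mul_smul_comm, smul_mul_assoc]
    by_cases h : v = v'
    · have hw : w' ≠ w := fun h' => hne' (by rw [h, h'])
      rw [← hr, mul_assoc, mul_assoc, he.ortho hw]
      simp
    · rw [← hl, ← mul_assoc, he.ortho h]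
      simp
  · simp

theorem linearIndependent_of_corners {E B V : Type*} [Field E] [Ring B] [Algebra E B]
    [Fintype V] {e : V → B} (he : OrthogonalIdempotents e) {y : V → V → B}
    (hl : ∀ v w, e v * y v w = y v w) (hr : ∀ v w, y v w * e w = y v w)
    (hne : ∀ v w, y v w ≠ 0) : LinearIndependent E fun p : V × V => y p.1 p.2 := by
  rw [Fintype.linearIndependent_iff]
  rintro c hc ⟨v, w⟩
  have := mul_sum_smul_mul_of_corners he hl hr c v w
  rw [hc, mul_zero, zero_mul] at this
  exact (smul_eq_zero.1 this.symm).resolve_right (hne v w)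

/-- If the number of members of a complete system of nonzero orthogonal idempotents in a simple
algebra is the square root of the dimension, the system extends to a system of matrix units. -/
theorem exists_matrixUnits {E B V : Type*} [Field E] [Ring B] [Algebra E B] [IsSimpleRing B]
    [FiniteDimensional E B] [Fintype V] [Nonempty V] {e : V → B} (he : CompleteOrthogonalIdempotents e)
    (hne : ∀ v, e v ≠ 0) (hcard : Module.finrank E B = Fintype.card V ^ 2) :
    ∃ x : V → V → B, (∀ v w u, x v w * x w u = x v u) ∧ (∀ v, x v v = e v) ∧
      ∀ v w b, ∃ a : E, e v * b * e w = a • x v w := by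
  classical
  -- Primeness supplies a nonzero element in each corner. These are independent and as many as the
  -- dimension, so every corner is a line.
  choose r hr using fun v w => exists_mul_mul_ne_zero (hne v) (hne w)
  let y : V → V → B := fun v w => e v * r v w * e w
  have hy0 : ∀ v w, y v w ≠ 0 := hr
  have hidem : ∀ v, e v * e v = e v := fun v => he.idem v
  have hley : ∀ v w, e v * y v w = y v w := fun v w => by simp only [y, ← mul_assoc, hidem]
  have hrey : ∀ v w, y v w * e w = y v w := fun v w => by simp only [y, mul_assoc, hidem]
  have hcorner := mul_sum_smul_mul_of_corners (E := E) he.toOrthogonalIdempotents hley hrey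
  have hli := linearIndependent_of_corners (E := E) he.toOrthogonalIdempotents hley hrey hy0
  have hspan := hli.span_eq_top_of_card_eq_finrank' (by
    rw [hcard, Fintype.card_prod, sq])
  have hone : ∀ v w b, ∃ a : E, e v * b * e w = a • y v w := by
    intro v w b
    have hb : b ∈ Submodule.span E (Set.range fun p : V × V => y p.1 p.2) :=
      hspan ▸ Submodule.mem_top
    obtain ⟨c, rfl⟩ := (Submodule.mem_span_range_iff_exists_fun E).1 hb
    exact ⟨_, hcorner c v w⟩
  have hdiag : ∀ v b, ∃ a : E, e v * b * e v = a • e v := by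
    intro v b
    obtain ⟨a, ha⟩ := hone v v b
    obtain ⟨a', ha'⟩ := hone v v 1
    rw [mul_one, hidem] at ha'
    have ha'0 : a' ≠ 0 := by
      rintro rfl
      exact hne v (by simpa using ha')
    exact ⟨a * a'⁻¹, by rw [ha, ha', smul_smul, inv_mul_cancel_right₀ ha'0]⟩
  obtain ⟨v₀⟩ := ‹Nonempty V›
  -- `q v` is an inverse of `y v v₀` across the corners. Routing all matrix units through `v₀`, as
  -- `y v v₀ * q w`, makes them multiply correctly.
  have hq : ∀ v, ∃ q, e v₀ * q = q ∧ q * e v = q ∧ q * y v v₀ = e v₀ := by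
    intro v
    obtain ⟨t, ht⟩ := exists_mul_mul_ne_zero (hne v₀) (hy0 v v₀)
    have h1 : e v₀ * t * y v v₀ = (e v₀ * t * e v) * y v v₀ := by
      conv_lhs => rw [← hley]
      simp only [mul_assoc]
    obtain ⟨d, hd⟩ := hdiag v₀ (t * y v v₀)
    have hd' : e v₀ * t * y v v₀ = d • e v₀ := by
      rw [← hd]; simp only [mul_assoc, hrey]
    have hd0 : d ≠ 0 := by
      rintro rfl
      exact ht (by simpa using hd')
    refine ⟨d⁻¹ • (e v₀ * t * e v), ?_, ?_, ?_⟩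
    · rw [mul_smul_comm]; simp only [← mul_assoc, hidem]
    · rw [smul_mul_assoc]; simp only [mul_assoc, hidem]
    · rw [smul_mul_assoc, ← h1, hd', smul_smul, inv_mul_cancel₀ hd0, one_smul]
  choose q hq1 hq2 hq3 using hq
  have hpq : ∀ v, y v v₀ * q v = e v := by
    intro v
    obtain ⟨a, ha⟩ := hdiag v (y v v₀ * q v)
    have ha' : y v v₀ * q v = a • e v := by
      rw [← ha, ← mul_assoc, hley, mul_assoc (y v v₀) (q v) (e v), hq2]
    have hsq : (y v v₀ * q v) * (y v v₀ * q v) = y v v₀ * q v := by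
      rw [mul_assoc, ← mul_assoc (q v), hq3, hq1]
    have ha0 : a ≠ 0 := by
      rintro rfl
      rw [zero_smul] at ha'
      apply hne v₀
      rw [← hidem, ← hq3 v, mul_assoc, ← mul_assoc (y v v₀), ha']
      simp
    rw [ha', smul_mul_smul_comm, hidem] at hsq
    have h2 : a * a = a := smul_left_injective E (hne v) hsq
    have : a = 1 := by simpa [ha0] using h2
    rw [ha', this, one_smul]
  refine ⟨fun v w => y v v₀ * q w, fun v w u => ?_, hpq, fun v w b => ?_⟩
  · rw [mul_assoc, ← mul_assoc (q w), hq3, hq1]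
  · obtain ⟨a, ha⟩ := hdiag v₀ (q v * b * y w v₀)
    refine ⟨a, ?_⟩
    have h1 : e v₀ * (q v * b * y w v₀) * e v₀ = q v * b * y w v₀ := by
      simp only [← mul_assoc, hq1]
      rw [mul_assoc _ (y w v₀), hrey]
    rw [h1] at ha
    calc e v * b * e w = (y v v₀ * q v) * b * (y w v₀ * q w) := by rw [hpq, hpq]
      _ = y v v₀ * (q v * b * y w v₀) * q w := by simp only [mul_assoc]
      _ = a • (y v v₀ * q w) := by
        rw [ha, mul_smul_comm, smul_mul_assoc, hrey]

end MatrixUnits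

/-! ### Idempotents from a subfield of the algebra -/

section Idempotents

variable {K E A : Type*} [Field K] [Field E] [Ring A] [Algebra K E] [Algebra K A]
  [FiniteDimensional K E] [IsGalois K E]

open Polynomial in
/-- A subfield `E^S` of `A` yields idempotents of `E ⊗ A`, permuted by the Galois group as the
cosets of `S`. -/
theorem exists_equivariant_idempotents (S : Subgroup Gal(E/K)) [Fintype (Gal(E/K) ⧸ S)]
    (j : IntermediateField.fixedField S →ₐ[K] A) :
    ∃ e : Gal(E/K) ⧸ S → E ⊗[K] A, CompleteOrthogonalIdempotents e ∧
      ∀ (σ : Gal(E/K)) v, σ • e v = e (σ • v) := by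
  classical
  let pb := Field.powerBasisOfFiniteOfSeparable K (IntermediateField.fixedField S)
  let node : Gal(E/K) ⧸ S → E := fun v => Quotient.liftOn' v (fun σ => σ • (pb.gen : E))
    (fun σ τ h => (smul_powerBasis_gen_eq_iff S σ τ).2 (by
      rw [← inv_mem_iff]; simpa using QuotientGroup.leftRel_apply.1 h))
  have hnode : ∀ σ : Gal(E/K), node (σ : Gal(E/K) ⧸ S) = σ • (pb.gen : E) := fun σ => rfl
  have hinj : Function.Injective node := by
    intro v w
    induction v using QuotientGroup.induction_on with | H σ => ?_
    induction w using QuotientGroup.induction_on with | H τ => ?_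
    intro h
    exact (QuotientGroup.eq.2 ((smul_powerBasis_gen_eq_iff S σ τ).1 h)).symm
  have hequiv : ∀ (σ : Gal(E/K)) v, node (σ • v) = σ (node v) := by
    intro σ v
    induction v using QuotientGroup.induction_on with | H τ => ?_
    exact mul_smul σ τ _
  have hdeg : (minpoly K pb.gen).natDegree = Fintype.card (Gal(E/K) ⧸ S) := by
    rw [pb.natDegree_minpoly, ← pb.finrank, IntermediateField.finrank_eq_fixingSubgroup_index,
      IntermediateField.fixingSubgroup_fixedField, Subgroup.index, Nat.card_eq_fintype_card]
  have hmonic := minpoly.monic pb.isIntegral_gen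
  have hnodal : Lagrange.nodal Finset.univ node = (minpoly K pb.gen).map (algebraMap K E) := by
    -- Both polynomials are monic of degree `[G : S]` and vanish at all conjugates of the generator.
    apply Polynomial.eq_of_degree_sub_lt_of_eval_index_eq (v := node) Finset.univ hinj.injOn
    · have := degree_sub_lt_left (p := Lagrange.nodal Finset.univ node)
        (q := (minpoly K pb.gen).map (algebraMap K E)) (by
          rw [Lagrange.degree_nodal, degree_map, degree_eq_natDegree hmonic.ne_zero, hdeg]; rfl)
        Lagrange.nodal_ne_zero (by rw [Lagrange.nodal_monic, hmonic.map])
      rwa [Lagrange.degree_nodal] at this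
    · intro v _
      rw [Lagrange.eval_nodal_at_node (Finset.mem_univ v)]
      induction v using QuotientGroup.induction_on with | H σ => ?_
      have h1 : aeval ((pb.gen : IntermediateField.fixedField S) : E) (minpoly K pb.gen) = 0 := by
        have := congrArg (IntermediateField.fixedField S).val (minpoly.aeval K pb.gen)
        rwa [← aeval_algHom_apply, map_zero] at this
      have h2 := congrArg (σ : E →ₐ[K] E) h1
      rw [← aeval_algHom_apply, map_zero] at h2
      rw [hnode, eval_map_algebraMap]
      exact h2.symm
  let α : E ⊗[K] A := 1 ⊗ₜ j pb.gen
  have hα : aeval α (Lagrange.nodal Finset.univ node) = 0 := by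
    rw [hnodal, aeval_map_algebraMap]
    have := congrArg (Algebra.TensorProduct.includeRight.comp j : _ →ₐ[K] E ⊗[K] A)
      (minpoly.aeval K pb.gen)
    rwa [← aeval_algHom_apply, map_zero] at this
  have hsum : ∑ v, aeval α (Lagrange.basis Finset.univ node v) = 1 := by
    rw [← map_sum, Lagrange.sum_basis hinj.injOn ⟨((1 : Gal(E/K)) : Gal(E/K) ⧸ S),
      Finset.mem_univ _⟩, map_one]
  -- The Lagrange basis polynomials are the idempotents of `E[X]` modulo the nodal polynomial, which
  -- kills `α`. As `α` is Galois-fixed, `σ` acts on their coefficients only and so permutes the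
  -- nodes.
  refine ⟨fun v => aeval α (Lagrange.basis Finset.univ node v),
    CompleteOrthogonalIdempotents.iff_ortho_complete.2 ⟨?_, hsum⟩, fun σ v => ?_⟩
  · intro v w hvw
    have hdvd : Lagrange.nodal Finset.univ node ∣
        Lagrange.basis Finset.univ node v * Lagrange.basis Finset.univ node w := by
      rw [Lagrange.nodal_eq_mul_nodal_erase (Finset.mem_univ v), mul_comm]
      apply mul_dvd_mul
      · rw [Lagrange.basis_eq_prod_sub_inv_mul_nodal_div (Finset.mem_univ v),
          ← Lagrange.nodal_erase_eq_nodal_div (Finset.mem_univ v)]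
        exact dvd_mul_left _ _
      · rw [dvd_iff_isRoot]
        exact Lagrange.eval_basis_of_ne hvw.symm (Finset.mem_univ v)
    obtain ⟨Q, hQ⟩ := hdvd
    change aeval α _ * aeval α _ = 0
    rw [← map_mul, hQ, map_mul, hα, zero_mul]
  · change σ • aeval α _ = _
    rw [gal_smul_aeval_one_tmul]
    congr 1
    rw [Lagrange.basis, Lagrange.basis, Polynomial.map_prod]
    refine Finset.prod_bij (fun w _ => σ • w) ?_ ?_ ?_ ?_
    · intro w hw
      simpa using hw
    · intro a _ b _ h
      exact MulAction.injective σ h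
    · intro w hw
      exact ⟨σ⁻¹ • w, by simpa [inv_smul_eq_iff] using hw, by simp⟩
    · intro w _
      simp [Lagrange.basisDivisor, hequiv]

end Idempotents

/-! ### Descent to the Galois-fixed part of a stable subfield -/

section Descent

/-- The restrictions of the elements of `Gal(E/K)` to a subfield on which it acts faithfully are
distinct. -/
theorem restrict_gal_injective {k K E : Type*} [Field k] [Field K] [Field E] [Algebra K E]
    [Algebra k E] {E₀ : IntermediateField k E}
    (hfaith : ∀ σ : Gal(E/K), (∀ a ∈ E₀, σ a = a) → σ = 1) :
    Function.Injective fun σ : Gal(E/K) =>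
      (((σ : E →ₐ[K] E) : E →* E).comp (E₀.val : E₀ →* E)) := by
  intro σ τ h
  have h1 : ∀ a ∈ E₀, σ a = τ a := fun a ha => DFunLike.congr_fun h ⟨a, ha⟩
  have := hfaith (τ⁻¹ * σ) fun a ha => by
    rw [AlgEquiv.mul_apply, h1 a ha, ← AlgEquiv.mul_apply, inv_mul_cancel, AlgEquiv.one_apply]
  exact (inv_mul_eq_one.1 this).symm

variable {k : Type w} {K E : Type u} [Field k] [Field K] [Field E] [Algebra k K] [Algebra K E]
  [Algebra k E] [IsScalarTower k K E] [FiniteDimensional K E] [IsGalois K E]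

/-- If `Gal(E/K)` acts faithfully on `E₀`, then `E₀` and `K` are linearly disjoint over `E₀ ∩ K`. -/
theorem eq_zero_of_sum_mul_eq_zero {E₀ : IntermediateField k E}
    (hstab : ∀ (σ : Gal(E/K)), ∀ a ∈ E₀, σ a ∈ E₀)
    (hfaith : ∀ σ : Gal(E/K), (∀ a ∈ E₀, σ a = a) → σ = 1)
    {ι : Type*} {κ : ι → K}
    (hκ : LinearIndependent (E₀.comap (IsScalarTower.toAlgHom k K E)) κ)
    {s : Finset ι} {d : ι → E} (hd : ∀ i, d i ∈ E₀)
    (hsum : ∑ i ∈ s, algebraMap K E (κ i) * d i = 0) : ∀ i ∈ s, d i = 0 := by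
  have htr : ∀ y ∈ E₀, Algebra.trace K E y ∈ E₀.comap (IsScalarTower.toAlgHom k K E) := by
    intro y hy
    change algebraMap K E (Algebra.trace K E y) ∈ E₀
    rw [trace_eq_sum_automorphisms]
    exact sum_mem fun σ _ => hstab σ y hy
  -- The trace of `a` times the relation is a relation among the `κ i` with coefficients in `E₀ ∩
  -- K`, hence trivial. Dedekind's lemma on `E₀` then turns `∑ σ(a) σ(d i) = 0` for all `a` into `d
  -- i = 0`.
  have h0 : ∀ a ∈ E₀, ∀ i ∈ s, Algebra.trace K E (a * d i) = 0 := by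
    intro a ha i hi
    have h1 : ∑ i ∈ s, Algebra.trace K E (a * d i) * κ i = 0 := by
      have := congrArg (fun z => Algebra.trace K E (a * z)) hsum
      simp only [Finset.mul_sum, map_sum, mul_zero, map_zero] at this
      rw [← this]
      refine Finset.sum_congr rfl fun i _ => ?_
      rw [mul_left_comm, ← Algebra.smul_def, map_smul, smul_eq_mul, mul_comm]
    have := linearIndependent_iff'.1 hκ s
      (fun i => ⟨_, htr (a * d i) (mul_mem ha (hd i))⟩) h1 i hi
    exact congrArg Subtype.val this
  intro i hi
  have := eq_zero_of_forall_sum_monoidHom_smul (restrict_gal_injective hfaith)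
    (x := fun σ : Gal(E/K) => σ (d i)) (fun a => by
      have h2 := congrArg (algebraMap K E) (h0 a a.2 i hi)
      rw [trace_eq_sum_automorphisms, map_zero] at h2
      simpa using h2) 1
  simpa using this

variable {A : Type v} [Ring A] [Algebra K A]

/-- The elements of `A` with coordinates in `E₀` in a system of matrix units of `E ⊗ A`. -/
def formSubalgebra {V : Type*} [Fintype V] (E₀ : IntermediateField k E) (x : V → V → E ⊗[K] A)
    (hmul : ∀ v w u, x v w * x w u = x v u) (hmul0 : ∀ v w w' u, w ≠ w' → x v w * x w' u = 0)
    (hone : ∑ v, x v v = 1) :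
    Subalgebra (E₀.comap (IsScalarTower.toAlgHom k K E)) A where
  carrier := {a | (1 : E) ⊗ₜ[K] a ∈ Submodule.span E₀ (Set.range fun p : V × V => x p.1 p.2)}
  add_mem' ha hb := by
    rw [Set.mem_ofPred_eq, TensorProduct.tmul_add]
    exact add_mem ha hb
  mul_mem' {a b} ha hb := by
    rw [Set.mem_ofPred_eq]
    have h1 : (1 : E) ⊗ₜ[K] (a * b) = (1 ⊗ₜ a) * (1 ⊗ₜ b) := by simp
    rw [h1]
    refine Submodule.span_induction₂ (p := fun c d _ _ => c * d ∈
      Submodule.span E₀ (Set.range fun p : V × V => x p.1 p.2)) ?_ ?_ ?_ ?_ ?_ ?_ ?_ ha hb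
    · rintro _ _ ⟨⟨v, w⟩, rfl⟩ ⟨⟨w', u⟩, rfl⟩
      by_cases h : w = w'
      · subst h
        simp only [hmul]
        exact Submodule.subset_span ⟨(v, u), rfl⟩
      · simp only [hmul0 v w w' u h]
        exact zero_mem _
    · intros; rw [zero_mul]; exact zero_mem _
    · intros; rw [mul_zero]; exact zero_mem _
    · intro _ _ _ _ _ _ h1 h2; rw [add_mul]; exact add_mem h1 h2
    · intro _ _ _ _ _ _ h1 h2; rw [mul_add]; exact add_mem h1 h2
    · intro r _ _ _ _ h; rw [smul_mul_assoc]; exact Submodule.smul_mem _ r h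
    · intro r _ _ _ _ h; rw [mul_smul_comm]; exact Submodule.smul_mem _ r h
  algebraMap_mem' r := by
    have h1 : (1 : E) ⊗ₜ[K] (algebraMap (E₀.comap (IsScalarTower.toAlgHom k K E)) A r) =
        (⟨algebraMap K E r, r.2⟩ : E₀) • ∑ v, x v v := by
      rw [hone]
      change (1 : E) ⊗ₜ[K] (algebraMap K A r) = (algebraMap K E r) • (1 : E ⊗[K] A)
      rw [Algebra.algebraMap_eq_smul_one, TensorProduct.tmul_smul, algebraMap_smul]
      rfl
    rw [Set.mem_ofPred_eq, h1]
    exact Submodule.smul_mem _ _ (sum_mem fun v _ => Submodule.subset_span ⟨(v, v), rfl⟩)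

/-- If `Gal(E/K)` acts faithfully on `E₀` and permutes a system of matrix units of `E ⊗ A` up to
factors in `E₀`, then `A` descends to `E₀ ∩ K`. -/
theorem descendsTo_comap [Algebra.IsCentral K A] [IsSimpleRing A] [FiniteDimensional K A]
    {V : Type*} [Fintype V] [MulAction Gal(E/K) V] {E₀ : IntermediateField k E}
    (hstab : ∀ (σ : Gal(E/K)), ∀ a ∈ E₀, σ a ∈ E₀)
    (hfaith : ∀ σ : Gal(E/K), (∀ a ∈ E₀, σ a = a) → σ = 1)
    {x : V → V → E ⊗[K] A} (hmul : ∀ v w u, x v w * x w u = x v u)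
    (hmul0 : ∀ v w w' u, w ≠ w' → x v w * x w' u = 0) (hone : ∑ v, x v v = 1)
    (hli : LinearIndependent E fun p : V × V => x p.1 p.2)
    (hspan : Submodule.span E (Set.range fun p : V × V => x p.1 p.2) = ⊤)
    (hx : ∀ (σ : Gal(E/K)) v w, ∃ a ∈ E₀, σ • x v w = a • x (σ • v) (σ • w)) :
    DescendsTo A (E₀.comap (IsScalarTower.toAlgHom k K E)) := by
  classical
  set B₀ := Submodule.span E₀ (Set.range fun p : V × V => x p.1 p.2)
  have hB₀stab : ∀ (σ : Gal(E/K)), ∀ b ∈ B₀, σ • b ∈ B₀ := by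
    intro σ b hb
    refine Submodule.span_induction (p := fun b _ => σ • b ∈ B₀) ?_ ?_ ?_ ?_ hb
    · rintro _ ⟨⟨v, w⟩, rfl⟩
      obtain ⟨a, ha, h⟩ := hx σ v w
      change σ • x v w ∈ B₀
      rw [h]
      exact Submodule.smul_mem _ (⟨a, ha⟩ : E₀) (Submodule.subset_span ⟨(σ • v, σ • w), rfl⟩)
    · rw [smul_zero]; exact zero_mem _
    · intro _ _ _ _ h1 h2; rw [smul_add]; exact add_mem h1 h2
    · intro r b _ h
      change σ • ((r : E) • b) ∈ B₀
      rw [gal_smul_smul]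
      exact Submodule.smul_mem _ (⟨_, hstab σ r r.2⟩ : E₀) h
  refine DescendsTo.of_bijective (formSubalgebra E₀ x hmul hmul0 hone) ⟨?_, ?_⟩
  · rw [injective_iff_map_eq_zero]
    intro t ht
    let κ := Module.Basis.ofVectorSpace (E₀.comap (IsScalarTower.toAlgHom k K E)) K
    obtain ⟨c, rfl⟩ := (TensorProduct.equivFinsuppOfBasisLeft κ).symm.surjective t
    rw [TensorProduct.equivFinsuppOfBasisLeft_symm_apply] at ht ⊢
    have hc : ∀ i, ∃ d : V × V → E, (∀ p, d p ∈ E₀) ∧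
        ∑ p, d p • x p.1 p.2 = (1 : E) ⊗ₜ[K] (c i : A) := by
      intro i
      obtain ⟨d, hd⟩ := (Submodule.mem_span_range_iff_exists_fun E₀).1 (c i).2
      exact ⟨fun p => d p, fun p => (d p).2, hd⟩
    choose d hd hdc using hc
    have h1 : ∑ i ∈ c.support, algebraMap K E (κ i) • ((1 : E) ⊗ₜ[K] (c i : A)) = 0 := by
      have h2 := congrArg (fun a => (1 : E) ⊗ₜ[K] a) ht
      simp only [Finsupp.sum, map_sum, TensorProduct.tmul_sum, TensorProduct.tmul_zero] at h2
      rw [← h2]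
      refine Finset.sum_congr rfl fun i _ => ?_
      rw [subalgebraMulMap_tmul, TensorProduct.tmul_smul, algebraMap_smul]
    have h3 : ∀ p, ∑ i ∈ c.support, algebraMap K E (κ i) * d i p = 0 := by
      refine Fintype.linearIndependent_iff.1 hli _ ?_
      rw [← h1]
      simp only [Finset.sum_smul, ← hdc, Finset.smul_sum, smul_smul]
      rw [Finset.sum_comm]
    have h4 : ∀ i ∈ c.support, c i = 0 := by
      intro i hi
      have h5 : (1 : E) ⊗ₜ[K] (c i : A) = 0 := by
        rw [← hdc]
        refine Finset.sum_eq_zero fun p _ => ?_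
        rw [eq_zero_of_sum_mul_eq_zero hstab hfaith κ.linearIndependent (fun i => hd i p)
          (h3 p) i hi, zero_smul]
      apply Subtype.ext
      exact Algebra.TensorProduct.includeRight_injective (A := E) (B := A) (R := K)
        (algebraMap K E).injective (by simpa using h5)
    exact Finset.sum_eq_zero fun i hi => by simp [h4 i hi]
  -- A functional `f` killing the form extends to `l` on `E ⊗ A`. For `b ∈ B₀` and `a ∈ E₀` the
  -- Galois sum of `a • b` comes from the form, so `∑ σ(a) l(σ b) = 0`, and Dedekind gives `l b =
  -- 0`. Since `B₀` spans, `l` and `f` vanish.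
  · have htop : Submodule.span K (formSubalgebra E₀ x hmul hmul0 hone : Set A) = ⊤ := by
      by_contra hne
      obtain ⟨f, hf0, hf⟩ := Submodule.exists_le_ker_of_lt_top _ (lt_top_iff_ne_top.2 hne)
      apply hf0
      let l : E ⊗[K] A →ₗ[E] E :=
        (TensorProduct.AlgebraTensorModule.rid K E E).toLinearMap ∘ₗ f.baseChange E
      have hl : ∀ a, l (1 ⊗ₜ a) = algebraMap K E (f a) := fun a => by
        simp [l, Algebra.algebraMap_eq_smul_one]
      have hlB : ∀ b ∈ B₀, l b = 0 := by
        intro b hb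
        have := eq_zero_of_forall_sum_monoidHom_smul (restrict_gal_injective hfaith)
          (x := fun σ : Gal(E/K) => l (σ • b)) (fun a => by
            have hfix : ∀ τ : Gal(E/K), τ • ∑ σ : Gal(E/K), σ • ((a : E) • b) =
                ∑ σ : Gal(E/K), σ • ((a : E) • b) := by
              intro τ
              rw [Finset.smul_sum]
              refine Fintype.sum_equiv (Equiv.mulLeft τ) _ _ fun σ => ?_
              rw [Equiv.coe_mulLeft, mul_smul]
            obtain ⟨a', ha'⟩ := exists_one_tmul_eq_of_fixed hfix
            have hmem : a' ∈ formSubalgebra E₀ x hmul hmul0 hone := by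
              change (1 : E) ⊗ₜ[K] a' ∈ B₀
              rw [ha']
              exact sum_mem fun σ _ => hB₀stab σ _ (Submodule.smul_mem _ a hb)
            have h6 : f a' = 0 := hf (Submodule.subset_span hmem)
            have h7 := hl a'
            rw [h6, ha', map_zero, map_sum] at h7
            simpa [gal_smul_smul] using h7) 1
        simpa using this
      have hl0 : l = 0 := by
        refine LinearMap.ext_on_range hspan fun p => ?_
        exact hlB _ (Submodule.subset_span ⟨p, rfl⟩)
      ext a
      have := hl a
      rw [hl0] at this
      simpa using this.symm
    intro a
    have ha : a ∈ Submodule.span K (formSubalgebra E₀ x hmul hmul0 hone : Set A) :=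
      htop ▸ Submodule.mem_top
    refine Submodule.span_induction (p := fun a _ => ∃ t,
      subalgebraMulMap (formSubalgebra E₀ x hmul hmul0 hone) t = a) ?_ ?_ ?_ ?_ ha
    · exact fun a ha => ⟨1 ⊗ₜ ⟨a, ha⟩, by rw [subalgebraMulMap_tmul, one_smul]⟩
    · exact ⟨0, map_zero _⟩
    · rintro _ _ _ _ ⟨t, rfl⟩ ⟨t', rfl⟩
      exact ⟨t + t', map_add _ _ _⟩
    · rintro r _ _ ⟨t, rfl⟩
      exact ⟨r • t, map_smul _ _ _⟩

end Descent

/-! ### The field of cycle values of an edge function -/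

open scoped IntermediateField.algebraAdjoinAdjoin in
theorem trdeg_adjoin_range_le {k E : Type*} [Field k] [Field E] [Algebra k E] {n : ℕ}
    (f : Fin n → E) :
    Algebra.trdeg k (IntermediateField.adjoin k (Set.range f)) ≤ n := by
  have h1 : Algebra.trdeg k (Algebra.adjoin k (Set.range f)) ≤ n := by
    rw [Algebra.adjoin_range_eq_range_aeval]
    have := lift_trdeg_le_of_surjective (MvPolynomial.aeval (R := k) f).rangeRestrict
      (MvPolynomial.aeval (R := k) f).rangeRestrict_surjective
    rw [MvPolynomial.trdeg_of_isDomain] at this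
    simpa using this
  have h2 := trdeg_add_eq k (Algebra.adjoin k (Set.range f))
    (A := IntermediateField.adjoin k (Set.range f))
  rw [trdeg_eq_zero (R := Algebra.adjoin k (Set.range f)), add_zero] at h2
  rwa [← h2]

section Cocycle

variable {k : Type w} {K E : Type u} [Field k] [Field K] [Field E] [Algebra k K] [Algebra K E]
  [Algebra k E] [IsScalarTower k K E] {X V : Type*}

/-- The multiplicative extension to chains of a function on the edges. -/
noncomputable def chainValue (τ : X → Eˣ) : (X →₀ ℤ) →ₗ[ℤ] Additive Eˣ :=
  Finsupp.linearCombination ℤ fun x => Additive.ofMul (τ x)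

/-- The action of the Galois group on the units. -/
noncomputable def galUnits (σ : Gal(E/K)) : Additive Eˣ →ₗ[ℤ] Additive Eˣ :=
  (Units.map ((σ : E →ₐ[K] E) : E →* E)).toAdditive.toIntLinearMap

theorem coe_toMul_galUnits (σ : Gal(E/K)) (a : Additive Eˣ) :
    (((galUnits σ a).toMul : Eˣ) : E) = σ ((a.toMul : Eˣ) : E) := rfl

theorem chainValue_single (τ : X → Eˣ) (x : X) :
    chainValue τ (Finsupp.single x 1) = Additive.ofMul (τ x) := by
  simp [chainValue]

theorem coe_toMul_chainValue [Fintype X] (τ : X → Eˣ) (p : X →₀ ℤ) :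
    (((chainValue τ p).toMul : Eˣ) : E) = ∏ x, (τ x : E) ^ p x := by
  rw [chainValue, Finsupp.linearCombination_apply, Finsupp.sum_fintype _ _ (by simp), toMul_sum,
    Units.coe_prod]
  simp

/-- The field generated by the values of a function on cycles. -/
noncomputable def cycleField (k : Type w) {E : Type u} [Field k] [Field E] [Algebra k E]
    (src tgt : X → V) (τ : X → Eˣ) : IntermediateField k E :=
  IntermediateField.adjoin k
    ((fun p => (((chainValue τ p).toMul : Eˣ) : E)) '' (LinearMap.ker (boundary src tgt) : Set _))

theorem coe_chainValue_mem_cycleField {src tgt : X → V} {τ : X → Eˣ} {p : X →₀ ℤ}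
    (hp : p ∈ LinearMap.ker (boundary src tgt)) :
    (((chainValue τ p).toMul : Eˣ) : E) ∈ cycleField k src tgt τ :=
  IntermediateField.subset_adjoin _ _ ⟨p, hp, rfl⟩

/-- The cycle lattice is free over `ℤ` and values are multiplicative, so the values on a basis
generate the field. -/
theorem trdeg_cycleField_le [Finite X] (src tgt : X → V) (τ : X → Eˣ) :
    Algebra.trdeg k (cycleField k src tgt τ) ≤
      (Module.finrank ℤ (LinearMap.ker (boundary src tgt)) : Cardinal) := by
  let b := Module.finBasis ℤ (LinearMap.ker (boundary src tgt))
  let f : Fin (Module.finrank ℤ (LinearMap.ker (boundary src tgt))) → E :=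
    fun i => (((chainValue τ (b i : X →₀ ℤ)).toMul : Eˣ) : E)
  have hle : cycleField k src tgt τ ≤ IntermediateField.adjoin k (Set.range f) := by
    rw [cycleField, IntermediateField.adjoin_le_iff]
    rintro _ ⟨p, hp, rfl⟩
    let W : AddSubgroup (Additive Eˣ) :=
      { carrier := {a | ((a.toMul : Eˣ) : E) ∈ IntermediateField.adjoin k (Set.range f)}
        add_mem' := fun {a b} ha hb => by
          simpa using mul_mem (S := IntermediateField k E) ha hb
        zero_mem' := one_mem (IntermediateField.adjoin k (Set.range f))
        neg_mem' := fun {a} ha => by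
          simpa using inv_mem (S := IntermediateField k E) ha }
    have hW : ⊤ ≤ W.toIntSubmodule.comap
        (chainValue τ ∘ₗ (LinearMap.ker (boundary src tgt)).subtype) := by
      rw [← b.span_eq, Submodule.span_le]
      rintro _ ⟨i, rfl⟩
      exact IntermediateField.subset_adjoin k _ ⟨i, rfl⟩
    exact hW (Submodule.mem_top (x := ⟨p, hp⟩))
  exact (trdeg_le_of_injective (IntermediateField.inclusion hle)
    (IntermediateField.inclusion hle).injective).trans (trdeg_adjoin_range_le f)

variable [MulAction Gal(E/K) X]

/-- By `hs`, `s σ v w` is the quotient of `s σ v v₀` by `s σ w v₀`, so the failure of equivariance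
telescopes along a chain and depends only on its boundary. On cycles the value is equivariant. -/
theorem chainValue_chainMap {src tgt : X → V} {τ : X → Eˣ} {s : Gal(E/K) → V → V → Eˣ} (v₀ : V)
    (hs : ∀ σ v w u, s σ v w * s σ w u = s σ v u)
    (hτ : ∀ (σ : Gal(E/K)) x, (τ (σ • x) : E) = σ (τ x) * s σ (tgt x) (src x))
    (σ : Gal(E/K)) (p : X →₀ ℤ) :
    chainValue τ (chainMap X σ p) = galUnits σ (chainValue τ p) +
      chainValue (fun v => s σ v v₀) (boundary src tgt p) := by
  have : chainValue τ ∘ₗ chainMap X σ = galUnits σ ∘ₗ chainValue τ +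
      chainValue (fun v => s σ v v₀) ∘ₗ boundary src tgt := by
    ext x : 2
    simp only [LinearMap.comp_apply, LinearMap.add_apply, Finsupp.lsingle_apply, chainMap_single,
      boundary_single, map_sub, chainValue_single]
    apply Additive.toMul.injective
    apply Units.ext
    have h1 : s σ (tgt x) v₀ / s σ (src x) v₀ = s σ (tgt x) (src x) := by
      rw [div_eq_iff_eq_mul, hs]
    rw [← ofMul_div, h1]
    exact hτ σ x
  exact LinearMap.congr_fun this p

variable [MulAction Gal(E/K) V] [FiniteDimensional K E] [IsGalois K E] {A : Type v} [Ring A] [Algebra K A]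

/-- The unit `x v w` is rescaled by the value `d v w` of a path from `w` to `v`. The scalar by which
`σ` then acts is the value of the cycle formed by the translated path minus the chosen path between
the translated ends. -/
theorem descendsTo_cycleField [Algebra.IsCentral K A] [IsSimpleRing A] [FiniteDimensional K A]
    [Fintype V] {src tgt : X → V} {v₀ : V}
    (hsrc : ∀ (σ : Gal(E/K)) x, src (σ • x) = σ • src x)
    (htgt : ∀ (σ : Gal(E/K)) x, tgt (σ • x) = σ • tgt x)
    (hconn : ∀ v, Finsupp.single v 1 - Finsupp.single v₀ 1 ∈ LinearMap.range (boundary src tgt))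
    {x : V → V → E ⊗[K] A} (hmul : ∀ v w u, x v w * x w u = x v u)
    (hmul0 : ∀ v w w' u, w ≠ w' → x v w * x w' u = 0) (hone : ∑ v, x v v = 1)
    (hli : LinearIndependent E fun p : V × V => x p.1 p.2)
    (hspan : Submodule.span E (Set.range fun p : V × V => x p.1 p.2) = ⊤)
    {τ : X → Eˣ} {s : Gal(E/K) → V → V → Eˣ}
    (hx : ∀ (σ : Gal(E/K)) v w, σ • x v w = (s σ v w : E) • x (σ • v) (σ • w))
    (hs : ∀ σ v w u, s σ v w * s σ w u = s σ v u)
    (hτ : ∀ (σ : Gal(E/K)) x, (τ (σ • x) : E) = σ (τ x) * s σ (tgt x) (src x))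
    (hfaith : ∀ σ : Gal(E/K), σ ≠ 1 → ∃ p ∈ LinearMap.ker (boundary src tgt),
      chainValue τ (chainMap X σ p - p) ≠ 0) :
    DescendsTo A ((cycleField k src tgt τ).comap (IsScalarTower.toAlgHom k K E)) := by
  have hcm := chainValue_chainMap v₀ hs hτ
  have hker : ∀ (σ : Gal(E/K)), ∀ p ∈ LinearMap.ker (boundary src tgt),
      chainValue τ (chainMap X σ p) = galUnits σ (chainValue τ p) := by
    intro σ p hp
    rw [hcm, LinearMap.mem_ker.1 hp, map_zero, add_zero]
  choose π hπ using hconn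
  let d : V → V → Eˣ := fun v w => (chainValue τ (π v - π w)).toMul
  have hd : ∀ v w u, (d v w : E) * d w u = d v u := by
    intro v w u
    rw [← Units.val_mul, ← toMul_add, ← map_add, sub_add_sub_cancel]
  have hd1 : ∀ v, (d v v : E) = 1 := by
    intro v
    simp [d]
  refine descendsTo_comap (x := fun v w => (d v w : E) • x v w) ?_ ?_ ?_ ?_ ?_ ?_ ?_ ?_
  · intro σ a ha
    have hle : cycleField k src tgt τ ≤ (cycleField k src tgt τ).comap
        (((σ : E →ₐ[K] E)).restrictScalars k) := by
      conv_lhs => rw [cycleField]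
      rw [IntermediateField.adjoin_le_iff]
      rintro _ ⟨p, hp, rfl⟩
      change σ _ ∈ cycleField k src tgt τ
      rw [← coe_toMul_galUnits, ← hker σ p hp]
      refine coe_chainValue_mem_cycleField ?_
      rw [LinearMap.mem_ker, boundary_chainMap hsrc htgt, LinearMap.mem_ker.1 hp, map_zero]
    exact hle ha
  · intro σ hσ
    by_contra hne
    obtain ⟨p, hp, hpne⟩ := hfaith σ hne
    apply hpne
    rw [map_sub, hker σ p hp, sub_eq_zero]
    apply Additive.toMul.injective
    apply Units.ext
    rw [coe_toMul_galUnits]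
    exact hσ _ (coe_chainValue_mem_cycleField hp)
  · intro v w u
    rw [smul_mul_smul_comm, hmul, hd]
  · intro v w w' u h
    rw [smul_mul_smul_comm, hmul0 _ _ _ _ h, smul_zero]
  · simp only [hd1, one_smul, hone]
  · exact hli.units_smul (fun p : V × V => d p.1 p.2)
  · rw [eq_top_iff, ← hspan, Submodule.span_le]
    rintro _ ⟨⟨v, w⟩, rfl⟩
    have := Submodule.smul_mem (Submodule.span E
      (Set.range fun p : V × V => (d p.1 p.2 : E) • x p.1 p.2)) ((d v w)⁻¹ : Eˣ).val
      (Submodule.subset_span ⟨(v, w), rfl⟩)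
    simpa [smul_smul] using this
  · intro σ v w
    let c : X →₀ ℤ := chainMap X σ (π v - π w) - (π (σ • v) - π (σ • w))
    have hc : c ∈ LinearMap.ker (boundary src tgt) := by
      rw [LinearMap.mem_ker, map_sub, boundary_chainMap hsrc htgt]
      simp [hπ]
    refine ⟨_, coe_chainValue_mem_cycleField hc, ?_⟩
    have h1 : (boundary src tgt) (π v - π w) = Finsupp.single v 1 - Finsupp.single w 1 := by
      simp [hπ]
    have h2 : s σ v v₀ / s σ w v₀ = s σ v w := by
      rw [div_eq_iff_eq_mul, hs]
    have h3 : (chainValue τ (chainMap X σ (π v - π w))).toMul =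
        (galUnits σ (Additive.ofMul (d v w))).toMul * s σ v w := by
      rw [hcm, h1, map_sub (chainValue fun v => s σ v v₀), chainValue_single, chainValue_single,
        ← ofMul_div, h2]
      rfl
    have h4 : (chainValue τ c).toMul * d (σ • v) (σ • w) =
        (chainValue τ (chainMap X σ (π v - π w))).toMul := by
      rw [← toMul_add, ← map_add, sub_add_cancel]
    rw [h3] at h4
    have h5 := congrArg Units.val h4
    rw [Units.val_mul, Units.val_mul, coe_toMul_galUnits] at h5
    rw [gal_smul_smul, hx, smul_smul, smul_smul, h5]
    rfl

end Cocycle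

/-! ### From a graph to a field of definition -/

section GraphDescent

variable {k : Type w} {K E : Type u} [Field k] [Field K] [Field E] [Algebra k K] [Algebra K E]
  [Algebra k E] [IsScalarTower k K E] [FiniteDimensional K E] [IsGalois K E]
  {A : Type v} [Ring A] [Algebra K A]

/-- If all the sums vanished, Dedekind's lemma would give `b = 0`. This makes averaging over an edge
stabilizer nonzero. -/
theorem exists_sum_gal_smul_ne_zero {K E A : Type*} [Field K] [Field E] [Algebra K E]
    [FiniteDimensional K E] [Ring A] [Algebra K A] (S : Subgroup Gal(E/K)) [Fintype S]
    {b : E ⊗[K] A} (hb : b ≠ 0) : ∃ a : E, ∑ σ : S, (σ : Gal(E/K)) • (a • b) ≠ 0 := by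
  by_contra! h
  apply hb
  have := eq_zero_of_forall_sum_monoidHom_smul
    (f := fun σ : S => (((σ : Gal(E/K)) : E →ₐ[K] E) : E →* E))
    (x := fun σ : S => (σ : Gal(E/K)) • b)
    (fun σ τ hστ => Subtype.ext (AlgEquiv.ext fun a => DFunLike.congr_fun hστ a))
    (fun a => by simpa [gal_smul_smul] using h a) 1
  simpa using this

/-- A connected vertex-transitive `Gal(E/K)`-graph whose vertices index suitable idempotents of
`E ⊗ A`, and on whose cycles the group acts faithfully, bounds the essential dimension of `A`. -/
theorem exists_descendsTo_of_graph [Algebra.IsCentral K A] [IsSimpleRing A]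
    [FiniteDimensional K A] [Infinite K] {V X : Type*} [Fintype V] [Finite X]
    [MulAction Gal(E/K) V] [MulAction Gal(E/K) X] [MulAction.IsPretransitive Gal(E/K) V]
    {src tgt : X → V} {v₀ : V}
    (hsrc : ∀ (σ : Gal(E/K)) x, src (σ • x) = σ • src x)
    (htgt : ∀ (σ : Gal(E/K)) x, tgt (σ • x) = σ • tgt x)
    (hconn : ∀ v, Finsupp.single v 1 - Finsupp.single v₀ 1 ∈ LinearMap.range (boundary src tgt))
    (hfaith : ∀ σ : Gal(E/K), σ ≠ 1 → ∃ p ∈ LinearMap.ker (boundary src tgt), chainMap X σ p ≠ p)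
    {e : V → E ⊗[K] A} (he : CompleteOrthogonalIdempotents e)
    (hequiv : ∀ (σ : Gal(E/K)) v, σ • e v = e (σ • v))
    (hcard : Module.finrank K A = Fintype.card V ^ 2) :
    ∃ K₀ : IntermediateField k K, DescendsTo A K₀ ∧ Algebra.trdeg k K₀ ≤
      (Module.finrank ℤ (LinearMap.ker (boundary src tgt)) : Cardinal) := by
  classical
  have := Fintype.ofFinite X
  have hsimple : IsSimpleRing (E ⊗[K] A) := isSimpleRing_baseChange K E A
  have hfin : Module.finrank E (E ⊗[K] A) = Fintype.card V ^ 2 := by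
    rw [Module.finrank_baseChange, hcard]
  have : Nonempty V := ⟨v₀⟩
  have hne : ∀ v, e v ≠ 0 := by
    intro v hv
    have h0 : ∀ w, e w = 0 := fun w => by
      obtain ⟨σ, rfl⟩ := MulAction.exists_smul_eq Gal(E/K) v w
      rw [← hequiv, hv, smul_zero]
    have := he.complete
    simp [h0] at this
  obtain ⟨x, hmul, hdiag, hcorner⟩ := exists_matrixUnits he hne hfin
  have hl : ∀ v w, e v * x v w = x v w := fun v w => by rw [← hdiag, hmul]
  have hr : ∀ v w, x v w * e w = x v w := fun v w => by rw [← hdiag, hmul]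
  have hx0 : ∀ v w, x v w ≠ 0 := fun v w h => hne v (by rw [← hdiag, ← hmul v w v, h, zero_mul])
  have hmul0 : ∀ v w w' u, w ≠ w' → x v w * x w' u = 0 := fun v w w' u h => by
    rw [← hr v w, ← hl w' u, mul_assoc, ← mul_assoc (e w), he.ortho h, zero_mul, mul_zero]
  have hone : ∑ v, x v v = 1 := by simp only [hdiag, he.complete]
  have hli := linearIndependent_of_corners (E := E) he.toOrthogonalIdempotents hl hr hx0
  have hspan := hli.span_eq_top_of_card_eq_finrank' (by rw [hfin, Fintype.card_prod, sq])
  have hs : ∀ (σ : Gal(E/K)) v w, ∃ a : Eˣ, σ • x v w = (a : E) • x (σ • v) (σ • w) := by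
    intro σ v w
    obtain ⟨a, ha⟩ := hcorner (σ • v) (σ • w) (σ • x v w)
    rw [← hequiv, ← hequiv, ← gal_smul_mul, ← gal_smul_mul, hl, hr] at ha
    have ha0 : a ≠ 0 := by
      rintro rfl
      rw [zero_smul, smul_eq_zero_iff_eq] at ha
      exact hx0 v w ha
    exact ⟨Units.mk0 a ha0, ha⟩
  choose s hxs using hs
  have hs : ∀ σ v w u, s σ v w * s σ w u = s σ v u := by
    intro σ v w u
    apply Units.ext
    have h1 : σ • (x v w * x w u) = σ • x v u := by rw [hmul]
    rw [gal_smul_mul, hxs, hxs, hxs, smul_mul_smul_comm, hmul] at h1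
    exact smul_left_injective E (hx0 (σ • v) (σ • u)) h1
  obtain ⟨y, hy, hyequiv⟩ := exists_equivariant_choice (Γ := Gal(E/K)) (X := X) (Y := E ⊗[K] A)
    (T := fun ε => {b | b ≠ 0 ∧ e (tgt ε) * b * e (src ε) = b})
    (fun σ ε b hb => by
      refine ⟨(smul_ne_zero_iff_ne σ).2 hb.1, ?_⟩
      rw [htgt, hsrc, ← hequiv, ← hequiv, ← gal_smul_mul, ← gal_smul_mul, hb.2])
    (fun ε => by
      obtain ⟨a, ha⟩ := exists_sum_gal_smul_ne_zero (MulAction.stabilizer Gal(E/K) ε)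
        (hx0 (tgt ε) (src ε))
      refine ⟨_, ⟨ha, ?_⟩, fun τ hτ => ?_⟩
      · rw [Finset.mul_sum, Finset.sum_mul]
        refine Finset.sum_congr rfl fun σ _ => ?_
        have hσ : (σ : Gal(E/K)) • ε = ε := σ.2
        have ht : e (tgt ε) = (σ : Gal(E/K)) • e (tgt ε) := by rw [hequiv, ← htgt, hσ]
        have hs' : e (src ε) = (σ : Gal(E/K)) • e (src ε) := by rw [hequiv, ← hsrc, hσ]
        conv_lhs => rw [ht, hs']
        rw [← gal_smul_mul, ← gal_smul_mul, mul_smul_comm, smul_mul_assoc, hl, hr]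
      · rw [Finset.smul_sum]
        refine Fintype.sum_equiv (Equiv.mulLeft (⟨τ, hτ⟩ : MulAction.stabilizer Gal(E/K) ε)) _ _
          fun σ => ?_
        rw [Equiv.coe_mulLeft, Subgroup.coe_mul, mul_smul])
  have hτ : ∀ ε, ∃ a : Eˣ, y ε = (a : E) • x (tgt ε) (src ε) := by
    intro ε
    obtain ⟨a, ha⟩ := hcorner (tgt ε) (src ε) (y ε)
    rw [(hy ε).2] at ha
    have ha0 : a ≠ 0 := by
      rintro rfl
      exact (hy ε).1 (by simpa using ha)
    exact ⟨Units.mk0 a ha0, ha⟩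
  choose τ hyτ using hτ
  have hτ : ∀ (σ : Gal(E/K)) ε, (τ (σ • ε) : E) = σ (τ ε) * s σ (tgt ε) (src ε) := by
    intro σ ε
    have h1 := hyequiv σ ε
    rw [hyτ, hyτ, gal_smul_smul, hxs, smul_smul, htgt, hsrc] at h1
    exact smul_left_injective E (hx0 _ _) h1
  -- Cycle values of `τ` alone need not distinguish `σ p` from `p`. The factor `c + η ε` is
  -- equivariant, so it preserves the relation `hτ`, and a generic `c ∈ K` separates the two values
  -- for every `σ ≠ 1`.
  obtain ⟨η, hηinj, hη⟩ := exists_equivariant_injective (K := K) (E := E) X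
  choose! p hpker hp using hfaith
  obtain ⟨c, hc0, hc⟩ := exists_translate_prod_zpow_ne_one (K := K) hηinj
    (ι := {σ : Gal(E/K) // σ ≠ 1}) (p := fun σ => ⇑(chainMap X σ.1 (p σ.1) - p σ.1))
    (u := fun σ => (((chainValue τ (chainMap X σ.1 (p σ.1) - p σ.1)).toMul : Eˣ) : E))
    (fun σ h => hp σ.1 σ.2 (sub_eq_zero.1 (DFunLike.coe_injective h)))
    (fun σ => Units.ne_zero _)
  let τ' : X → Eˣ := fun ε => τ ε * Units.mk0 _ (hc0 ε)
  refine ⟨(cycleField k src tgt τ').comap (IsScalarTower.toAlgHom k K E),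
    descendsTo_cycleField (τ := τ') hsrc htgt hconn hmul hmul0 hone hli hspan hxs hs ?_ ?_, ?_⟩
  · intro σ ε
    simp only [τ', Units.val_mul, Units.val_mk0, hτ, hη, map_mul, map_add, σ.commutes]
    change _ * (_ + σ (η ε)) = _
    ring
  · intro σ hσ
    refine ⟨p σ, hpker σ hσ, fun h => hc ⟨σ, hσ⟩ ?_⟩
    have h1 : (((chainValue τ' (chainMap X σ (p σ) - p σ)).toMul : Eˣ) : E) = 1 := by rw [h]; rfl
    rw [coe_toMul_chainValue] at h1 ⊢
    simp only [τ', Units.val_mul, Units.val_mk0, mul_zpow, Finset.prod_mul_distrib] at h1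
    exact h1
  · refine le_trans ?_ (trdeg_cycleField_le (k := k) src tgt τ')
    let f : (cycleField k src tgt τ').comap (IsScalarTower.toAlgHom k K E) →ₐ[k]
        cycleField k src tgt τ' :=
      ((IsScalarTower.toAlgHom k K E).comp ((cycleField k src tgt τ').comap
        (IsScalarTower.toAlgHom k K E)).val).codRestrict
        (cycleField k src tgt τ').toSubalgebra fun a => a.2
    exact trdeg_le_of_injective f f.toRingHom.injective

end GraphDescent

/-! ### The coset graph and its cycles -/

section CosetGraph

variable {Γ : Type*} [Group Γ]

theorem mem_conjSubgroup_iff {H : Subgroup Γ} {g x : Γ} :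
    x ∈ conjSubgroup H g ↔ g⁻¹ * x * g ∈ H := by
  rw [conjSubgroup, Subgroup.mem_map]
  constructor
  · rintro ⟨h, hh, rfl⟩
    simpa [mul_assoc] using hh
  · intro h
    exact ⟨_, h, by simp [mul_assoc]⟩

/-- The edges of the coset graph of `H` with connection elements `g i`. -/
abbrev CosetEdge (H : Subgroup Γ) {ι : Type*} (g : ι → Γ) :=
  Σ i, Γ ⧸ (H ⊓ conjSubgroup H (g i))

variable {ι : Type*} (H : Subgroup Γ) (g : ι → Γ)

/-- The edge `x (H ∩ H^{g i})` has source `x H`. -/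
def edgeSrc (ε : CosetEdge H g) : Γ ⧸ H :=
  Quotient.map' id (fun a b h => by
    rw [QuotientGroup.leftRel_apply] at h ⊢
    exact h.1) ε.2

/-- The edge `x (H ∩ H^{g i})` has target `x (g i) H`. -/
def edgeTgt (ε : CosetEdge H g) : Γ ⧸ H :=
  Quotient.map' (· * g ε.1) (fun a b h => by
    rw [QuotientGroup.leftRel_apply] at h ⊢
    simpa [mul_assoc] using mem_conjSubgroup_iff.1 h.2) ε.2

theorem edgeSrc_mk (i : ι) (x : Γ) : edgeSrc H g ⟨i, (x : Γ ⧸ _)⟩ = (x : Γ ⧸ H) := rfl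

theorem edgeTgt_mk (i : ι) (x : Γ) : edgeTgt H g ⟨i, (x : Γ ⧸ _)⟩ = ((x * g i : Γ) : Γ ⧸ H) := rfl

theorem edgeSrc_smul (σ : Γ) (ε : CosetEdge H g) : edgeSrc H g (σ • ε) = σ • edgeSrc H g ε := by
  obtain ⟨i, q⟩ := ε
  induction q using QuotientGroup.induction_on with | H x => ?_
  rfl

theorem edgeTgt_smul (σ : Γ) (ε : CosetEdge H g) : edgeTgt H g (σ • ε) = σ • edgeTgt H g ε := by
  obtain ⟨i, q⟩ := ε
  induction q using QuotientGroup.induction_on with | H x => ?_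
  exact congrArg (QuotientGroup.mk (s := H)) (mul_assoc σ x (g i))

theorem edgeSrc_surjective [Nonempty ι] : Function.Surjective (edgeSrc H g) := by
  intro v
  induction v using QuotientGroup.induction_on with | H x => ?_
  exact ⟨⟨Classical.arbitrary ι, (x : Γ ⧸ _)⟩, rfl⟩

/-- The coset graph is connected if the connection elements generate the group over `H`. -/
theorem single_sub_single_mem_range_boundary
    (hgen : Subgroup.closure (Set.range g ∪ (H : Set Γ)) = ⊤) (v : Γ ⧸ H) :
    Finsupp.single v 1 - Finsupp.single ((1 : Γ) : Γ ⧸ H) 1 ∈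
      LinearMap.range (boundary (edgeSrc H g) (edgeTgt H g)) := by
  have hstab : ∀ (σ : Γ), ∀ c ∈ LinearMap.range (boundary (edgeSrc H g) (edgeTgt H g)),
      chainMap _ σ c ∈ LinearMap.range (boundary (edgeSrc H g) (edgeTgt H g)) := by
    rintro σ _ ⟨c, rfl⟩
    exact ⟨chainMap _ σ c, boundary_chainMap (edgeSrc_smul H g) (edgeTgt_smul H g) σ c⟩
  have hsmul : ∀ σ x : Γ, σ • (x : Γ ⧸ H) = ((σ * x : Γ) : Γ ⧸ H) := fun _ _ => rfl
  let S : Subgroup Γ :=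
    { carrier := {x | Finsupp.single (x : Γ ⧸ H) 1 - Finsupp.single ((1 : Γ) : Γ ⧸ H) 1 ∈
        LinearMap.range (boundary (edgeSrc H g) (edgeTgt H g))}
      one_mem' := by
        rw [Set.mem_ofPred_eq, sub_self]
        exact zero_mem _
      mul_mem' := fun {a b} ha hb => by
        rw [Set.mem_ofPred_eq] at ha hb ⊢
        have := add_mem (hstab a _ hb) ha
        rwa [map_sub, chainMap_single, chainMap_single, hsmul, hsmul, mul_one,
          sub_add_sub_cancel] at this
      inv_mem' := fun {a} ha => by
        rw [Set.mem_ofPred_eq] at ha ⊢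
        have := neg_mem (hstab a⁻¹ _ ha)
        rwa [map_sub, chainMap_single, chainMap_single, hsmul, hsmul, mul_one,
          inv_mul_cancel, neg_sub] at this }
  have hS : S = ⊤ := by
    rw [eq_top_iff, ← hgen, Subgroup.closure_le]
    rintro x (⟨i, rfl⟩ | hx)
    · refine ⟨Finsupp.single ⟨i, ((1 : Γ) : Γ ⧸ _)⟩ 1, ?_⟩
      rw [boundary_single, edgeSrc_mk, edgeTgt_mk, one_mul]
    · have : (x : Γ ⧸ H) = ((1 : Γ) : Γ ⧸ H) := by
        rw [eq_comm, QuotientGroup.eq]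
        simpa using hx
      change Finsupp.single (x : Γ ⧸ H) 1 - Finsupp.single ((1 : Γ) : Γ ⧸ H) 1 ∈
        LinearMap.range (boundary (edgeSrc H g) (edgeTgt H g))
      rw [this, sub_self]
      exact zero_mem _
  induction v using QuotientGroup.induction_on with | H x => ?_
  have : x ∈ S := hS ▸ Subgroup.mem_top x
  exact this

theorem exists_smul_coset_ne (hcore : H.normalCore = ⊥) {σ : Γ} (hσ : σ ≠ 1) :
    ∃ v : Γ ⧸ H, σ • v ≠ v := by
  by_contra! h
  apply hσ
  rw [← Subgroup.mem_bot, ← hcore]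
  intro b
  have := (QuotientGroup.eq.1 (h ((b⁻¹ : Γ) : Γ ⧸ H)))
  rw [← inv_mem_iff]
  simpa [mul_assoc] using this

/-- If every vertex of the coset graph is the source of a single edge, then the graph is a cycle
on a cyclic group. -/
theorem isCyclic_of_edgeSrc_injective [Finite Γ] [Nonempty ι] (hcore : H.normalCore = ⊥)
    (hgen : Subgroup.closure (Set.range g ∪ (H : Set Γ)) = ⊤)
    (hinj : Function.Injective (edgeSrc H g)) : IsCyclic Γ ∧ H = ⊥ := by
  have hsub : Subsingleton ι := ⟨fun i j => by
    have := @hinj ⟨i, ((1 : Γ) : Γ ⧸ _)⟩ ⟨j, ((1 : Γ) : Γ ⧸ _)⟩ rfl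
    exact congrArg Sigma.fst this⟩
  -- The edges of type `i` leaving the coset `H` correspond to `H / (H ∩ H^{g i})`, which is now a
  -- single point. As the group is finite, the inclusion makes `g i` normalize `H`.
  have hle : ∀ i, H ≤ conjSubgroup H (g i) := by
    intro i h hh
    have := @hinj ⟨i, (h : Γ ⧸ _)⟩ ⟨i, ((1 : Γ) : Γ ⧸ _)⟩ (by
      rw [edgeSrc_mk, edgeSrc_mk, eq_comm, QuotientGroup.eq]
      simpa using hh)
    have h1 := eq_of_heq (Sigma.mk.inj this).2
    rw [eq_comm, QuotientGroup.eq] at h1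
    simpa using h1.2
  have hnorm : H.Normal := by
    rw [← Subgroup.normalizer_eq_top_iff, eq_top_iff, ← hgen, Subgroup.closure_le]
    rintro x (⟨i, rfl⟩ | hx)
    · rw [SetLike.mem_coe, ← inv_mem_iff]
      refine Subgroup.mem_normalizer_fintype fun n hn => ?_
      simpa using mem_conjSubgroup_iff.1 (hle i hn)
    · exact Subgroup.le_normalizer hx
  have hH : H = ⊥ := by rw [← hcore, Subgroup.normalCore_eq_self]
  refine ⟨?_, hH⟩
  let i := Classical.arbitrary ι
  refine ⟨g i, fun x => ?_⟩
  have hx : x ∈ Subgroup.closure (Set.range g ∪ (H : Set Γ)) := hgen ▸ Subgroup.mem_top x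
  refine (Subgroup.closure_le (Subgroup.zpowers (g i))).2 ?_ hx
  rintro y (⟨j, rfl⟩ | hy)
  · rw [Subsingleton.elim j i]
    exact Subgroup.mem_zpowers _
  · rw [hH] at hy
    rw [Subgroup.mem_bot.1 hy]
    exact one_mem _

/-- Since the core is trivial, `σ` moves a coset. If it fixed all cycles, the edge count would force
out-degree one, hence the excluded cyclic case. -/
theorem exists_cycle_moved [Finite Γ] [Finite ι] (hcore : H.normalCore = ⊥)
    (hgen : Subgroup.closure (Set.range g ∪ (H : Set Γ)) = ⊤) (hcyc : IsCyclic Γ → H ≠ ⊥)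
    {σ : Γ} (hσ : σ ≠ 1) :
    ∃ p ∈ LinearMap.ker (boundary (edgeSrc H g) (edgeTgt H g)), chainMap _ σ p ≠ p := by
  -- Without connection elements `H` is the whole group and equals its trivial core, contradicting
  -- `σ ≠ 1`.
  have : Nonempty ι := by
    by_contra hempty
    rw [not_nonempty_iff] at hempty
    rw [Set.range_eq_empty, Set.empty_union, Subgroup.closure_eq] at hgen
    subst hgen
    rw [Subgroup.normalCore_eq_self] at hcore
    exact hσ (Subgroup.mem_bot.1 (hcore ▸ Subgroup.mem_top σ))
  by_contra! h
  obtain ⟨v, hv⟩ := exists_smul_coset_ne H hcore hσ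
  obtain ⟨h1, h2⟩ := isCyclic_of_edgeSrc_injective H g hcore hgen
    (src_injective_of_fixes_cycles (edgeSrc_smul H g) (edgeTgt_smul H g) (edgeSrc_surjective H g)
      (single_sub_single_mem_range_boundary H g hgen) h hv)
  exact hcyc h1 h2

end CosetGraph

/-! ### The bound for subgroups of the Galois group -/

theorem descendsTo_top {k : Type w} {K : Type u} [Field k] [Field K] [Algebra k K] (A : Type v)
    [Ring A] [Algebra K A] [Algebra.IsCentral K A] [IsSimpleRing A] [FiniteDimensional K A] :
    DescendsTo A (⊤ : IntermediateField k K) := by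
  refine DescendsTo.of_bijective (⊤ : Subalgebra (⊤ : IntermediateField k K) A) ⟨?_, fun a =>
    ⟨1 ⊗ₜ ⟨a, trivial⟩, by rw [subalgebraMulMap_tmul, one_smul]⟩⟩
  have hpure : ∀ t : K ⊗[(⊤ : IntermediateField k K)]
      (⊤ : Subalgebra (⊤ : IntermediateField k K) A), ∃ a, t = 1 ⊗ₜ a := by
    intro t
    induction t using TensorProduct.induction_on with
    | zero => exact ⟨0, by simp⟩
    | tmul r a =>
      refine ⟨(⟨r, trivial⟩ : (⊤ : IntermediateField k K)) • a, ?_⟩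
      rw [TensorProduct.tmul_smul, TensorProduct.smul_tmul']
      congr 1
      exact (mul_one r).symm
    | add x y hx hy =>
      obtain ⟨a, rfl⟩ := hx
      obtain ⟨b, rfl⟩ := hy
      exact ⟨a + b, (TensorProduct.tmul_add _ _ _).symm⟩
  rw [injective_iff_map_eq_zero]
  intro t ht
  obtain ⟨a, rfl⟩ := hpure t
  rw [subalgebraMulMap_tmul, one_smul] at ht
  have ha : a = 0 := Subtype.ext ht
  rw [ha, TensorProduct.tmul_zero]

theorem exists_descendsTo_trdeg_le {k : Type w} {K E : Type u} [Field k] [Field K] [Field E]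
    [Algebra k K] [Algebra K E] [FiniteDimensional K E] [IsGalois K E] {A : Type v} [Ring A]
    [Algebra K A] [Algebra.IsCentral K A] [IsSimpleRing A] [FiniteDimensional K A]
    {H : Subgroup Gal(E/K)} (hcore : H.normalCore = ⊥) {ι : Type*} [Finite ι] {g : ι → Gal(E/K)}
    (hgen : Subgroup.closure (Set.range g ∪ (H : Set Gal(E/K))) = ⊤)
    (hcyc : IsCyclic Gal(E/K) → H ≠ ⊥) (j : IntermediateField.fixedField H →ₐ[K] A)
    (hdeg : Module.finrank K (IntermediateField.fixedField H) ^ 2 = Module.finrank K A) :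
    ∃ K₀ : IntermediateField k K, DescendsTo A K₀ ∧ Algebra.trdeg k K₀ ≤
      (Module.finrank ℤ (LinearMap.ker (boundary (edgeSrc H g) (edgeTgt H g))) : Cardinal) := by
  -- The generic choices need `K` infinite. A finite `K` is algebraic over `k`, so `K` itself has
  -- transcendence degree zero.
  rcases finite_or_infinite K with hK | hK
  · refine ⟨⊤, descendsTo_top A, ?_⟩
    have : Module.Finite k K := inferInstance
    rw [trdeg_eq_zero]
    exact zero_le
  · let _ : Algebra k E := ((algebraMap K E).comp (algebraMap k K)).toAlgebra
    have : IsScalarTower k K E := IsScalarTower.of_algebraMap_eq fun _ => rfl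
    have := Fintype.ofFinite (Gal(E/K) ⧸ H)
    obtain ⟨e, he, hequiv⟩ := exists_equivariant_idempotents H j
    refine exists_descendsTo_of_graph (edgeSrc_smul H g) (edgeTgt_smul H g)
      (single_sub_single_mem_range_boundary H g hgen)
      (fun σ hσ => exists_cycle_moved H g hcore hgen hcyc hσ) he hequiv ?_
    rw [← hdeg, IntermediateField.finrank_eq_fixingSubgroup_index,
      IntermediateField.fixingSubgroup_fixedField, Subgroup.index, Nat.card_eq_fintype_card]

/-! ### Transport from the abstract group and conclusion -/

section Transport

variable {Γ G : Type*} [Group Γ] [Group G] (e : Γ ≃* G) (H : Subgroup G)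

theorem normalCore_comap_equiv (hcore : H.normalCore = ⊥) :
    (H.comap e.toMonoidHom).normalCore = ⊥ := by
  rw [eq_bot_iff]
  intro a ha
  have : e a ∈ H.normalCore := fun b => by
    have := ha (e.symm b)
    simpa using this
  rw [hcore, Subgroup.mem_bot] at this
  simpa using this

theorem closure_comap_equiv {ι : Type*} {g : ι → G}
    (hgen : Subgroup.closure (Set.range g ∪ (H : Set G)) = ⊤) :
    Subgroup.closure (Set.range (fun i => e.symm (g i)) ∪
      (H.comap e.toMonoidHom : Set Γ)) = ⊤ := by
  have h1 : Set.range (fun i => e.symm (g i)) ∪ (H.comap e.toMonoidHom : Set Γ) =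
      e.symm.toMonoidHom '' (Set.range g ∪ (H : Set G)) := by
    rw [Set.image_union, ← Set.range_comp]
    congr 1
    ext x
    constructor
    · exact fun hx => ⟨e x, hx, by simp⟩
    · rintro ⟨y, hy, rfl⟩
      simpa using hy
  rw [h1, ← MonoidHom.map_closure, hgen, ← MonoidHom.range_eq_map,
    MonoidHom.range_eq_top.2 e.symm.surjective]

theorem index_inf_conjSubgroup_comap_equiv (g : G) :
    (H.comap e.toMonoidHom ⊓ conjSubgroup (H.comap e.toMonoidHom) (e.symm g)).index =
      (H ⊓ conjSubgroup H g).index := by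
  rw [← Subgroup.index_comap_of_surjective (H ⊓ conjSubgroup H g) (f := e.toMonoidHom) e.surjective]
  congr 1
  ext x
  simp [mem_conjSubgroup_iff]

end Transport

theorem theorem4p1 {k : Type*} {K : Type*} {A : Type*} {G : Type*}
    [Field k] [Field K] [Algebra k K]
    [Ring A] [Algebra K A] [Algebra.IsCentral K A] [IsSimpleRing A] [FiniteDimensional K A]
    [Group G] [Finite G] (H : Subgroup G)
    (hA : IsCrossedProduct K A H)
    {s : ℕ} (g : Fin s → G)
    (hgen : Subgroup.closure (Set.range g ∪ (H : Set G)) = ⊤)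
    (hcyc : IsCyclic G → H ≠ ⊥) :
    ∃ d : ℕ, essentialDim k K A = (d : Cardinal) ∧
      (d : ℤ) ≤ (∑ i, ((H ⊓ conjSubgroup H (g i)).index : ℤ)) - (H.index : ℤ) + 1 := by
  obtain ⟨hcore, E, _, _, _, _, e, ⟨j⟩, hdeg⟩ := hA
  have hgen' := closure_comap_equiv e H hgen
  have hcyc' : IsCyclic Gal(E/K) → H.comap e.toMonoidHom ≠ ⊥ := by
    intro h hbot
    refine hcyc (isCyclic_of_surjective e e.surjective) ?_
    rw [eq_bot_iff]
    intro x hx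
    have : e.symm x ∈ H.comap e.toMonoidHom := by simpa using hx
    rw [hbot, Subgroup.mem_bot] at this
    simpa using this
  obtain ⟨K₀, hK₀, hle⟩ := exists_descendsTo_trdeg_le (k := k) (normalCore_comap_equiv e H hcore)
    hgen' hcyc' j hdeg
  have hed : essentialDim k K A ≤ Algebra.trdeg k K₀ := csInf_le' ⟨K₀, hK₀, rfl⟩
  obtain ⟨d, hd⟩ := Cardinal.lt_aleph0.1 ((hed.trans hle).trans_lt (Cardinal.natCast_lt_aleph0))
  refine ⟨d, hd, ?_⟩
  have hdr := hed.trans hle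
  rw [hd, Nat.cast_le] at hdr
  have := Fintype.ofFinite (Gal(E/K) ⧸ H.comap e.toMonoidHom)
  have := Fintype.ofFinite (CosetEdge (H.comap e.toMonoidHom) fun i => e.symm (g i))
  -- The cycle rank is at most edges - vertices + 1, with `[G : H]` vertices and one orbit of `[G :
  -- H ∩ H^{g i}]` edges for each `i`.
  have hrank := finrank_ker_boundary_le (single_sub_single_mem_range_boundary
    (H.comap e.toMonoidHom) (fun i => e.symm (g i)) hgen')
  have hV : Fintype.card (Gal(E/K) ⧸ H.comap e.toMonoidHom) = H.index := by
    rw [← Nat.card_eq_fintype_card]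
    exact Subgroup.index_comap_of_surjective H (f := e.toMonoidHom) e.surjective
  have hX : Fintype.card (CosetEdge (H.comap e.toMonoidHom) fun i => e.symm (g i)) =
      ∑ i, (H ⊓ conjSubgroup H (g i)).index := by
    rw [← Nat.card_eq_fintype_card, Nat.card_sigma]
    exact Finset.sum_congr rfl fun i _ => index_inf_conjSubgroup_comap_equiv e H (g i)
  rw [hV, hX] at hrank
  rw [← Nat.cast_sum]
  omega
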